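/- Let $d(n)$ be the divisor function and $\lambda(n)$ Liouville's function, and let $A_2>0$ be the constant for which $$\sum_{m<x}\frac{d(m)^2}{m}=A_2\log^4 x+O(\log^3 x)\qquad (x\to\infty);$$ in particular such a constant exists. For $T>1$ put $$\omega(\tfrac12+it)=\frac{\log T}{\sqrt{\pi}\,T}\,e^{-(t-T)^2\log^2T/T^2}\qquad(t\in\mathbb R)$$ and, for $n\ge 1$, $$b(n)=-\frac{2}{\log T}\sum_{\substack{n=mp^j\\ m<T/\log^{2}T\\ p^j<T}}\log p\,\Bigl(1-\frac{\log p^j}{\log T}\Bigr)\lambda(m)d(m),$$ where the sum runs over positive integers $m$, primes $p$ and integers $j\ge1$. Then for all sufficiently large real $T$ $$\int_{-\infty}^{\infty}\omega(\tfrac12+it)\,\Bigl|\sum_{n\ge T/\log^2T}\frac{b(n)}{n^{1/2+it}}\Bigr|^2\,dt>0.009\,A_2\log^4T .$$ -/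

import Mathlib

noncomputable section

namespace LongDirichlet

/-- The Gaussian weight `ω(1/2 + it) = (log T / (√π T)) exp (-(t - T)² log² T / T²)`. -/
def omega (T t : ℝ) : ℝ :=
  Real.log T / (Real.sqrt Real.pi * T) *
    Real.exp (-((t - T) ^ 2 * Real.log T ^ 2 / T ^ 2))

/-- The cut-off `T / log² T`. -/
def cutoff (T : ℝ) : ℝ := T / Real.log T ^ 2

/-- The divisor function `d(n)`. -/
def d (n : ℕ) : ℕ := n.divisors.card

/-- `b(n) = -(2 / log T) ∑ log p (1 - log p^j / log T) λ(m) d(m)`, the sum being over the ways of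
writing `n = m q` with `q = p^j` a prime power (`j ≥ 1`), `m < T / log² T` and `q < T`. The von
Mangoldt function `Λ(q)` is `log p` if `q = p^j` with `p` prime and `j ≥ 1`, and `0` for
all other `q`. -/
def b (T : ℝ) (n : ℕ) : ℝ :=
  -(2 / Real.log T) *
    ∑ x ∈ n.divisorsAntidiagonal with (x.1 : ℝ) < cutoff T ∧ (x.2 : ℝ) < T,
      ArithmeticFunction.vonMangoldt x.2 * (1 - Real.log x.2 / Real.log T) *
        (ArithmeticFunction.liouville x.1 : ℝ) * (d x.1 : ℝ)

/-- The sequence `b` has finite support. -/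
theorem b_eq_zero_of_le {T : ℝ} (hT : 0 ≤ T) {n : ℕ} (hn : cutoff T * T ≤ n) : b T n = 0 := by
  unfold b
  rw [Finset.filter_eq_empty_iff.mpr, Finset.sum_empty, mul_zero]
  rintro ⟨m, q⟩ hx ⟨h1, h2⟩
  have hmq : m * q = n := (Nat.mem_divisorsAntidiagonal.mp hx).1
  have h3 : (m : ℝ) * q = n := by exact_mod_cast hmq
  have hc : 0 ≤ cutoff T := div_nonneg hT (sq_nonneg _)
  have h4 : (m : ℝ) * q < cutoff T * T :=
    mul_lt_mul'' h1 h2 (Nat.cast_nonneg m) (Nat.cast_nonneg q)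
  linarith

/-- The tail `∑_{n ≥ T / log² T} b(n) n^{-1/2 - it}`; only finitely many terms are nonzero. -/
def tail (T t : ℝ) : ℂ :=
  ∑' n : {n : ℕ // cutoff T ≤ (n : ℝ)},
    (b T n : ℂ) / ((n : ℕ) : ℂ) ^ ((1 / 2 : ℂ) + t * Complex.I)

/-- `A` is the constant `A₂`: `∑_{m < x} d(m)² / m = A log⁴ x + O(log³ x)` as `x → ∞`. -/
def IsA2 (A : ℝ) : Prop :=
  (fun x : ℝ => (∑ m ∈ Finset.Ico 1 ⌈x⌉₊, (d m : ℝ) ^ 2 / (m : ℝ)) - A * Real.log x ^ 4)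
    =O[Filter.atTop] fun x : ℝ => Real.log x ^ 3

end LongDirichlet

end

/-!
The sequence `b` is a Dirichlet convolution: with
`A(t) = ∑_{m < x} λ(m) d(m) m^(-1/2-it)`, `x = T / log² T`, and
`Y(t) = -(2 / log T) ∑_{q < T} Λ(q) (1 - log q / log T) q^(-1/2-it)`, the polynomial with
coefficients `b` is the product `A Y`. Write `A Y = H + P`, where the head `H` collects the `n < x`
and `P` is the tail.

The weight `ω` has width `T / log T`, so two frequencies with a gap of at least `log² T / (2 T)` are
orthogonal up to `exp (-log² T / 16)` (`abs_integral_sub_diagonal_le`), which is smaller than any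
power of `T`. The logarithms of distinct positive integers, one of them below `x`, have such gaps.
Hence `P` is orthogonal to `H`, and the mean square of `P` is that of `A Y` minus that of `H`, the
latter being `∑_{n < x} b(n)² / n`.

The mean square of `A Y` is out of reach of this orthogonality, because `A Y` is long. But
`|A Y| = |A · conj Y|`, and `A · conj Y` has the frequencies `log (m / q)` with `m < x`, whose inner
product with any polynomial of length `x` is again diagonal. The coefficient of `n^(-1/2-it)` in the
projection of `A · conj Y` is `w(n) = ∑_{n q < x} λ(nq) d(nq) y(q) / q` (`corrCoeff`). As
`λ(p) d(p) = -2`, the terms of this sum do not cancel, and Mertens' theorem gives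
`λ(n) w(n) ≈ 2 d(n) (1 - v²)` with `v = log n / log T` (`exists_corrCoeff_ge`). Bessel's inequality,
in the form `|u|² ≥ 2 Re (u conj w) - |w|²`, therefore bounds the mean square of `A Y` below by
about `∑ d(n)² / n · 4 (1 - v²)²`.

For the head, `|b(n)| ≤ d(n) v` follows from `Λ * d = (d log) / 2`. Keeping part of what the factor
`1 - log q / log T` saves, the mean square of the head is at most about
`∑ d(n)² / n · (v² - v (1 - v)²)` (`sq_b_le`, `exists_gain_ge`). Since
`∑_{n < x} d(n)² / n ~ A₂ log⁴ x`, the variable `v` has density `4 A₂ v³ log⁴ T` on `[0, 1]`, and the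
difference of the two bounds is
`A₂ log⁴ T ∫ 4 v³ (4 (1 - v²)² - v² + v (1 - v)²) dv = (4 / 105) A₂ log⁴ T`, where `4 / 105 > 0.038`.

The existence of `A₂` follows from `d² = μ² * 1 * 1 * 1` and `∑ μ²(n) / n = log x / ζ(2) + O(1)`:
each convolution with `1` preserves an asymptotic formula of this shape
(`HasLogMean.sum_divisors`).
-/

open Finset Filter Topology MeasureTheory
open scoped ArithmeticFunction.vonMangoldt ArithmeticFunction.Moebius ArithmeticFunction.zeta
open scoped ComplexConjugate

namespace LongDirichlet

/-! ### Logarithmic means -/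

/-- The logarithmic sum `∑_{1 ≤ n < N} F(n) / n`. -/
noncomputable def logSum (F : ℕ → ℝ) (N : ℕ) : ℝ := ∑ n ∈ Ico 1 N, F n / n

/-- `F` has logarithmic mean `A` of order `r + 1`:
`∑_{1 ≤ n < N} F(n) / n = A log^(r+1) N + O((1 + log N)^r)`. -/
def HasLogMean (F : ℕ → ℝ) (A : ℝ) (r : ℕ) : Prop :=
  ∃ C, ∀ N : ℕ, 1 ≤ N → |logSum F N - A * Real.log N ^ (r + 1)| ≤ C * (1 + Real.log N) ^ r

theorem pow_sub_pow_le_mul {a b : ℝ} (ha : 0 ≤ a) (hab : a ≤ b) (r : ℕ) :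
    b ^ (r + 1) - a ^ (r + 1) ≤ (r + 1) * b ^ r * (b - a) := by
  induction r with
  | zero => simp
  | succ r ih =>
    have h1 : a ^ (r + 1) ≤ b ^ (r + 1) := pow_le_pow_left₀ ha hab _
    have h2 := mul_le_mul_of_nonneg_left ih (ha.trans hab)
    have h3 := mul_le_mul_of_nonneg_right h1 (sub_nonneg.2 hab)
    push_cast
    calc b ^ (r + 1 + 1) - a ^ (r + 1 + 1)
        = b * (b ^ (r + 1) - a ^ (r + 1)) + a ^ (r + 1) * (b - a) := by ring
      _ ≤ b * ((r + 1) * b ^ r * (b - a)) + b ^ (r + 1) * (b - a) := add_le_add h2 h3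
      _ = _ := by ring

theorem mul_le_pow_sub_pow {a b : ℝ} (ha : 0 ≤ a) (hab : a ≤ b) (r : ℕ) :
    (r + 1) * a ^ r * (b - a) ≤ b ^ (r + 1) - a ^ (r + 1) := by
  induction r with
  | zero => simp
  | succ r ih =>
    have h1 : a ^ (r + 1) ≤ b ^ (r + 1) := pow_le_pow_left₀ ha hab _
    have h2 := mul_le_mul_of_nonneg_left ih ha
    have h3 := mul_le_mul_of_nonneg_right h1 (sub_nonneg.2 hab)
    push_cast
    calc (r + 1 + 1) * a ^ (r + 1) * (b - a)
        = a * ((r + 1) * a ^ r * (b - a)) + a ^ (r + 1) * (b - a) := by ring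
      _ ≤ a * (b ^ (r + 1) - a ^ (r + 1)) + b ^ (r + 1) * (b - a) := add_le_add h2 h3
      _ = _ := by ring

theorem HasLogMean.nonneg_const {F : ℕ → ℝ} {A : ℝ} {r : ℕ} (h : HasLogMean F A r) :
    ∃ C, 0 ≤ C ∧ ∀ N : ℕ, 1 ≤ N →
      |logSum F N - A * Real.log N ^ (r + 1)| ≤ C * (1 + Real.log N) ^ r := by
  obtain ⟨C, hC⟩ := h
  have := (abs_nonneg _).trans (hC 1 le_rfl)
  exact ⟨C, by simpa using this, hC⟩

theorem log_ceil_sub_log_le {x : ℝ} (hx : 1 ≤ x) :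
    Real.log x ≤ Real.log ⌈x⌉₊ ∧ Real.log ⌈x⌉₊ - Real.log x ≤ 1 := by
  have h0 : 0 < x := by linarith
  have h1 := Nat.le_ceil x
  refine ⟨Real.log_le_log h0 h1, ?_⟩
  have h2 := Nat.ceil_lt_add_one h0.le
  have h3 : Real.log ⌈x⌉₊ ≤ Real.log (2 * x) := Real.log_le_log (by linarith) (by linarith)
  rw [Real.log_mul (by norm_num) h0.ne'] at h3
  have := Real.log_two_lt_d9
  linarith

/-- The asymptotic formula of `HasLogMean` for sums up to a real number. -/
theorem HasLogMean.real {F : ℕ → ℝ} {A : ℝ} {r : ℕ} (h : HasLogMean F A r) :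
    ∃ C, 0 ≤ C ∧ ∀ x : ℝ, 1 ≤ x →
      |logSum F ⌈x⌉₊ - A * Real.log x ^ (r + 1)| ≤ C * (1 + Real.log x) ^ r := by
  obtain ⟨C, hC0, hC⟩ := h.nonneg_const
  refine ⟨C * 2 ^ r + |A| * ((r + 1) * 2 ^ r), by positivity, fun x hx => ?_⟩
  obtain ⟨h1, h2⟩ := log_ceil_sub_log_le hx
  have hl : 0 ≤ Real.log x := Real.log_nonneg hx
  have hN : 1 ≤ ⌈x⌉₊ := Nat.one_le_ceil_iff.2 (by linarith)
  set a := Real.log x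
  set b := Real.log ⌈x⌉₊
  have h3 := hC _ hN
  have h4 : (1 + b) ^ r ≤ 2 ^ r * (1 + a) ^ r := by
    rw [← mul_pow]; exact pow_le_pow_left₀ (by linarith) (by linarith) _
  have h5 : |A * b ^ (r + 1) - A * a ^ (r + 1)| ≤ |A| * ((r + 1) * (2 ^ r * (1 + a) ^ r)) := by
    rw [← mul_sub, abs_mul]
    refine mul_le_mul_of_nonneg_left ?_ (abs_nonneg _)
    rw [abs_of_nonneg (sub_nonneg.2 (pow_le_pow_left₀ hl h1 _))]
    refine (pow_sub_pow_le_mul hl h1 r).trans ?_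
    have h6 : b ^ r ≤ (1 + b) ^ r := pow_le_pow_left₀ (by linarith) (by linarith) _
    have h7 : (r + 1) * b ^ r * (b - a) ≤ (r + 1) * b ^ r * 1 :=
      mul_le_mul_of_nonneg_left h2 (by have := hl.trans h1; positivity)
    have h8 : (0:ℝ) ≤ r + 1 := by positivity
    nlinarith
  calc |logSum F ⌈x⌉₊ - A * a ^ (r + 1)|
      = |(logSum F ⌈x⌉₊ - A * b ^ (r + 1)) + (A * b ^ (r + 1) - A * a ^ (r + 1))| := by
        congr 1; ring
    _ ≤ C * (1 + b) ^ r + |A| * ((r + 1) * (2 ^ r * (1 + a) ^ r)) :=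
        (abs_add_le _ _).trans (add_le_add h3 h5)
    _ ≤ C * (2 ^ r * (1 + a) ^ r) + |A| * ((r + 1) * (2 ^ r * (1 + a) ^ r)) := by gcongr
    _ = _ := by ring

theorem log_succ_sub_log_mem {n : ℕ} (hn : 1 ≤ n) :
    0 ≤ Real.log (n + 1 : ℕ) - Real.log n ∧ Real.log (n + 1 : ℕ) - Real.log n ≤ 1 := by
  have h0 : (0:ℝ) < n := by exact_mod_cast hn
  have h1 : (1:ℝ) ≤ n := by exact_mod_cast hn
  push_cast
  refine ⟨sub_nonneg.2 (Real.log_le_log h0 (by linarith)), ?_⟩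
  rw [← Real.log_div (by positivity) h0.ne']
  refine (Real.log_le_sub_one_of_pos (by positivity)).trans ?_
  rw [sub_le_iff_le_add, div_le_iff₀ h0]; linarith

/-- Partial summation: weighting by `log n` raises the order by one and changes the constant
from `A` to `A (r + 1) / (r + 2)`. -/
theorem HasLogMean.mul_log {F : ℕ → ℝ} {A : ℝ} {r : ℕ} (h : HasLogMean F A r) :
    HasLogMean (fun n => F n * Real.log n) (A * (r + 1) / (r + 2)) (r + 1) := by
  obtain ⟨C, hC0, hC⟩ := h.nonneg_const
  refine ⟨2 * C + |A|, fun N hN => ?_⟩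
  set δ : ℕ → ℝ := fun n => Real.log (n + 1 : ℕ) - Real.log n with hδ
  have hl1 : ∀ n : ℕ, 0 ≤ Real.log n := fun n => Real.log_natCast_nonneg n
  set l := Real.log N with hl
  have hl0 : 0 ≤ l := hl1 N
  -- Abel summation
  have habel : logSum (fun n => F n * Real.log n) N =
      logSum F N * l - ∑ n ∈ Ico 1 N, logSum F (n + 1) * δ n := by
    rw [hl]
    induction N, hN using Nat.le_induction with
    | base => simp [logSum]
    | succ N hN ih =>
      have ih' := ih rfl (hl1 N)
      have e1 : ∀ G : ℕ → ℝ, logSum G (N + 1) = logSum G N + G N / N := fun G => by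
        unfold logSum; rw [Finset.sum_Ico_succ_top hN]
      rw [Finset.sum_Ico_succ_top hN, e1, ih', e1 F]
      simp only [hδ]; ring
  have hδsum : ∑ n ∈ Ico 1 N, δ n = l := by
    rw [hδ, Finset.sum_Ico_sub (fun n => Real.log n) hN]; simp [hl]
  have hδ0 : ∀ n ∈ Ico 1 N, 0 ≤ δ n ∧ δ n ≤ 1 := fun n hn =>
    log_succ_sub_log_mem (Finset.mem_Ico.1 hn).1
  set Sg := ∑ n ∈ Ico 1 N, Real.log (n + 1 : ℕ) ^ (r + 1) * δ n with hSg
  -- `Sg` is an upper Riemann sum of `∫ u^(r+1) du` over `[0, l]`, off by at most `l^(r+1)`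
  have hlow : l ^ (r + 2) ≤ (r + 2) * Sg := by
    have : ∑ n ∈ Ico 1 N, (Real.log (n + 1 : ℕ) ^ (r + 2) - Real.log n ^ (r + 2)) ≤
        ∑ n ∈ Ico 1 N, (r + 2) * (Real.log (n + 1 : ℕ) ^ (r + 1) * δ n) := by
      refine Finset.sum_le_sum fun n hn => ?_
      have := pow_sub_pow_le_mul (hl1 n) (sub_nonneg.1 (hδ0 n hn).1) (r + 1)
      push_cast at this ⊢
      simp only [hδ]; push_cast
      linarith
    rw [← Finset.mul_sum, Finset.sum_Ico_sub (fun n => Real.log n ^ (r + 2)) hN] at this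
    simpa [hl, hSg] using this
  have hupp : (r + 2) * Sg ≤ l ^ (r + 2) + (r + 2) * l ^ (r + 1) := by
    have : ∑ n ∈ Ico 1 N, (r + 2) * (Real.log (n + 1 : ℕ) ^ (r + 1) * δ n) ≤
        ∑ n ∈ Ico 1 N, ((Real.log (n + 1 : ℕ) ^ (r + 2) - Real.log n ^ (r + 2)) +
          (r + 2) * (Real.log (n + 1 : ℕ) ^ (r + 1) - Real.log n ^ (r + 1))) := by
      refine Finset.sum_le_sum fun n hn => ?_
      obtain ⟨h0, h1⟩ := hδ0 n hn
      have h2 := mul_le_pow_sub_pow (hl1 n) (sub_nonneg.1 h0) (r + 1)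
      have h3 : Real.log n ^ (r + 1) ≤ Real.log (n + 1 : ℕ) ^ (r + 1) :=
        pow_le_pow_left₀ (hl1 n) (sub_nonneg.1 h0) _
      have h4 : (Real.log (n + 1 : ℕ) ^ (r + 1) - Real.log n ^ (r + 1)) * δ n ≤
          (Real.log (n + 1 : ℕ) ^ (r + 1) - Real.log n ^ (r + 1)) * 1 :=
        mul_le_mul_of_nonneg_left h1 (sub_nonneg.2 h3)
      have h5 := mul_le_mul_of_nonneg_left h4 (show (0:ℝ) ≤ r + 2 by positivity)
      have h6 : ((r + 1 : ℕ) + 1 : ℝ) * Real.log n ^ (r + 1) * δ n ≤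
        Real.log (n + 1 : ℕ) ^ (r + 2) - Real.log n ^ (r + 2) := h2
      push_cast at h6 h5 ⊢
      linarith
    rw [← Finset.mul_sum, Finset.sum_add_distrib, ← Finset.mul_sum,
      Finset.sum_Ico_sub (fun n => Real.log n ^ (r + 2)) hN,
      Finset.sum_Ico_sub (fun n => Real.log n ^ (r + 1)) hN] at this
    simpa [hl, hSg] using this
  have hE : |∑ n ∈ Ico 1 N, (logSum F (n + 1) - A * Real.log (n + 1 : ℕ) ^ (r + 1)) * δ n| ≤
      C * (1 + l) ^ r * l := by
    refine (Finset.abs_sum_le_sum_abs _ _).trans ?_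
    rw [← hδsum, Finset.mul_sum]
    refine Finset.sum_le_sum fun n hn => ?_
    rw [abs_mul, abs_of_nonneg (hδ0 n hn).1]
    refine mul_le_mul_of_nonneg_right ((hC (n + 1) (by omega)).trans ?_) (hδ0 n hn).1
    have h7 : Real.log (n + 1 : ℕ) ≤ l := by
      apply Real.log_le_log (by positivity)
      exact_mod_cast (Finset.mem_Ico.1 hn).2
    have := hl1 (n + 1)
    rw [hδsum]
    gcongr
  have hsplit : ∑ n ∈ Ico 1 N, logSum F (n + 1) * δ n = A * Sg +
      ∑ n ∈ Ico 1 N, (logSum F (n + 1) - A * Real.log (n + 1 : ℕ) ^ (r + 1)) * δ n := by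
    rw [hSg, Finset.mul_sum, ← Finset.sum_add_distrib]
    exact Finset.sum_congr rfl fun n _ => by ring
  have hr : (0:ℝ) < r + 2 := by positivity
  have hdiff : |Sg - l ^ (r + 2) / (r + 2)| ≤ l ^ (r + 1) := by
    rw [abs_le]
    constructor
    · have h8 : l ^ (r + 2) / (r + 2) ≤ Sg := by rw [div_le_iff₀ hr]; linarith
      have : 0 ≤ l ^ (r + 1) := by positivity
      linarith
    · have h8 : Sg ≤ (l ^ (r + 2) + (r + 2) * l ^ (r + 1)) / (r + 2) := by
        rw [le_div_iff₀ hr]; linarith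
      rw [add_div, mul_div_cancel_left₀ _ hr.ne'] at h8
      linarith
  rw [habel, hsplit]
  have hm := hC N hN
  have e2 : logSum F N * l - (A * Sg +
      ∑ n ∈ Ico 1 N, (logSum F (n + 1) - A * Real.log (n + 1 : ℕ) ^ (r + 1)) * δ n) -
      A * (r + 1) / (r + 2) * l ^ (r + 1 + 1) =
      (logSum F N - A * l ^ (r + 1)) * l - A * (Sg - l ^ (r + 2) / (r + 2)) -
      ∑ n ∈ Ico 1 N, (logSum F (n + 1) - A * Real.log (n + 1 : ℕ) ^ (r + 1)) * δ n := by
    field_simp; ring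
  rw [e2]
  refine (abs_sub _ _).trans ((add_le_add (abs_sub _ _) hE).trans ?_)
  rw [abs_mul, abs_mul, abs_of_nonneg hl0]
  have h9 : |logSum F N - A * l ^ (r + 1)| * l ≤ C * (1 + l) ^ r * l :=
    mul_le_mul_of_nonneg_right hm hl0
  have h10 : |A| * |Sg - l ^ (r + 2) / (r + 2)| ≤ |A| * (1 + l) ^ (r + 1) :=
    mul_le_mul_of_nonneg_left (hdiff.trans (pow_le_pow_left₀ hl0 (by linarith) _)) (abs_nonneg _)
  have h11 : C * (1 + l) ^ r * l ≤ C * (1 + l) ^ (r + 1) := by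
    rw [pow_succ, ← mul_assoc]
    exact mul_le_mul_of_nonneg_left (by linarith) (by positivity)
  linarith

/-- Grouping pairs `(m, q)` with `m q < x` by their product or by the value of `m`. -/
theorem sum_Ico_divisorsAntidiagonal {M : Type*} [AddCommMonoid M] (x : ℝ) (f : ℕ × ℕ → M) :
    ∑ n ∈ Ico 1 ⌈x⌉₊, ∑ z ∈ n.divisorsAntidiagonal, f z =
      ∑ m ∈ Ico 1 ⌈x⌉₊, ∑ q ∈ Ico 1 ⌈x / m⌉₊, f (m, q) := by
  rw [Finset.sum_sigma', Finset.sum_sigma']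
  refine Finset.sum_nbij' (fun z => ⟨z.2.1, z.2.2⟩) (fun z => ⟨z.1 * z.2, (z.1, z.2)⟩)
    ?_ ?_ ?_ ?_ ?_
  · rintro ⟨n, m, q⟩ hz
    simp only [Finset.mem_sigma, Finset.mem_Ico, Nat.mem_divisorsAntidiagonal, Nat.lt_ceil] at hz ⊢
    obtain ⟨⟨h1, h2⟩, rfl, h3⟩ := hz
    have hm : 0 < m := Nat.pos_of_ne_zero (by rintro rfl; simp at h3)
    have hq : 0 < q := Nat.pos_of_ne_zero (by rintro rfl; simp at h3)
    have hm' : (0:ℝ) < m := by exact_mod_cast hm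
    have hq' : (1:ℝ) ≤ q := by exact_mod_cast hq
    push_cast at h2
    refine ⟨⟨hm, by nlinarith⟩, hq, ?_⟩
    rw [lt_div_iff₀ hm']; linarith
  · rintro ⟨m, q⟩ hz
    simp only [Finset.mem_sigma, Finset.mem_Ico, Nat.mem_divisorsAntidiagonal, Nat.lt_ceil] at hz ⊢
    obtain ⟨⟨h1, h2⟩, h3, h4⟩ := hz
    have hm' : (0:ℝ) < m := by exact_mod_cast h1
    rw [lt_div_iff₀ hm'] at h4
    push_cast
    exact ⟨⟨Nat.mul_pos h1 h3, by linarith⟩, trivial, (Nat.mul_pos h1 h3).ne'⟩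
  · rintro ⟨n, m, q⟩ hz
    simp only [Finset.mem_sigma, Nat.mem_divisorsAntidiagonal] at hz
    obtain ⟨-, rfl, -⟩ := hz
    rfl
  · rintro ⟨m, q⟩ _; rfl
  · rintro ⟨n, m, q⟩ _; rfl

theorem hasLogMean_one : HasLogMean (fun _ => 1) 1 0 := by
  refine ⟨1, fun N hN => ?_⟩
  have e : logSum (fun _ => 1) N = (harmonic (N - 1) : ℝ) := by
    unfold logSum harmonic
    rw [Finset.sum_Ico_eq_sum_range]
    push_cast
    exact Finset.sum_congr rfl fun i _ => by rw [one_div, add_comm]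
  have h1 := log_add_one_le_harmonic (N - 1)
  have h2 := harmonic_le_one_add_log (N - 1)
  rw [e]
  have h3 : Real.log (N - 1 : ℕ) ≤ Real.log N := by
    rcases Nat.eq_zero_or_pos (N - 1) with h | h
    · rw [h]; simpa using Real.log_natCast_nonneg N
    · exact Real.log_le_log (by exact_mod_cast h) (by exact_mod_cast Nat.sub_le N 1)
  rw [Nat.sub_add_cancel hN] at h1
  simp only [zero_add, pow_one, pow_zero, mul_one, one_mul]
  rw [abs_le]; constructor <;> linarith

/-- Dirichlet convolution with the constant function `1` raises the order by one and divides
the constant by `r + 2`. -/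
theorem HasLogMean.sum_divisors {F : ℕ → ℝ} {A : ℝ} {r : ℕ} (h : HasLogMean F A r)
    (hF : ∀ n, 0 ≤ F n) :
    HasLogMean (fun n => ∑ m ∈ n.divisors, F m) (A / (r + 2)) (r + 1) := by
  obtain ⟨C₁, hC₁, h1⟩ := hasLogMean_one.real
  obtain ⟨C₂, hC₂, h2⟩ := h.mul_log.nonneg_const
  obtain ⟨C₃, hC₃, h3⟩ := h.nonneg_const
  refine ⟨C₃ + C₂ + C₁ * (C₃ + |A|), fun N hN => ?_⟩
  have e1 : logSum (fun n => ∑ m ∈ n.divisors, F m) N =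
      ∑ m ∈ Ico 1 N, F m / m * logSum (fun _ => 1) ⌈(N:ℝ) / m⌉₊ := by
    have := sum_Ico_divisorsAntidiagonal (N:ℝ) (fun z => F z.1 / z.1 * (1 / (z.2:ℝ)))
    rw [Nat.ceil_natCast] at this
    simp only [logSum, Finset.mul_sum]
    rw [← this]
    refine Finset.sum_congr rfl fun n hn => ?_
    rw [Finset.sum_div, Nat.sum_divisorsAntidiagonal fun m q : ℕ => F m / m * (1 / (q:ℝ))]
    refine Finset.sum_congr rfl fun m hm => ?_
    have hd := Nat.dvd_of_mem_divisors hm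
    have hm0 : (m:ℝ) ≠ 0 := by exact_mod_cast (Nat.pos_of_mem_divisors hm).ne'
    have hn0 : (n:ℝ) ≠ 0 := by
      have := (Finset.mem_Ico.1 hn).1
      exact_mod_cast (show n ≠ 0 by omega)
    rw [Nat.cast_div hd hm0]
    field_simp
  set l := Real.log N with hl
  have hl0 : 0 ≤ l := Real.log_natCast_nonneg N
  have hS0 : 0 ≤ logSum F N := Finset.sum_nonneg fun n _ => div_nonneg (hF n) n.cast_nonneg
  have hS : logSum F N ≤ (C₃ + |A|) * (1 + l) ^ (r + 1) := by
    have h4 := (abs_le.1 (h3 N hN)).2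
    have h5 : A * l ^ (r + 1) ≤ |A| * (1 + l) ^ (r + 1) :=
      mul_le_mul (le_abs_self A) (pow_le_pow_left₀ hl0 (by linarith) _) (by positivity)
        (abs_nonneg _)
    have h6 : C₃ * (1 + l) ^ r ≤ C₃ * (1 + l) ^ (r + 1) :=
      mul_le_mul_of_nonneg_left (pow_le_pow_right₀ (by linarith) (by omega)) hC₃
    linarith
  have hE : |∑ m ∈ Ico 1 N, F m / m * (logSum (fun _ => 1) ⌈(N:ℝ) / m⌉₊ - Real.log (N / m))| ≤
      C₁ * logSum F N := by
    refine (Finset.abs_sum_le_sum_abs _ _).trans ?_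
    rw [logSum, Finset.mul_sum]
    refine Finset.sum_le_sum fun m hm => ?_
    have hm' := Finset.mem_Ico.1 hm
    have hm0 : (0:ℝ) < m := by exact_mod_cast hm'.1
    have h7 := h1 (N / m) (by rw [le_div_iff₀ hm0, one_mul]; exact_mod_cast hm'.2.le)
    rw [abs_mul, abs_of_nonneg (div_nonneg (hF m) m.cast_nonneg), mul_comm]
    refine mul_le_mul_of_nonneg_right ?_ (div_nonneg (hF m) m.cast_nonneg)
    simpa using h7
  -- replacing the harmonic sums by `log (N / m)` reduces to `HasLogMean.mul_log`
  have e2 : logSum (fun n => ∑ m ∈ n.divisors, F m) N =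
      logSum F N * l - logSum (fun n => F n * Real.log n) N +
      ∑ m ∈ Ico 1 N, F m / m * (logSum (fun _ => 1) ⌈(N:ℝ) / m⌉₊ - Real.log (N / m)) := by
    rw [e1, logSum, logSum, Finset.sum_mul, ← Finset.sum_sub_distrib, ← Finset.sum_add_distrib]
    refine Finset.sum_congr rfl fun m hm => ?_
    have hm' := Finset.mem_Ico.1 hm
    have hm0 : (m:ℝ) ≠ 0 := by exact_mod_cast (show m ≠ 0 by omega)
    have hN0 : (N:ℝ) ≠ 0 := by exact_mod_cast (show N ≠ 0 by omega)
    rw [Real.log_div hN0 hm0, ← hl]; ring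
  have e3 : logSum (fun n => ∑ m ∈ n.divisors, F m) N - A / (r + 2) * l ^ (r + 1 + 1) =
      (logSum F N - A * l ^ (r + 1)) * l -
      (logSum (fun n => F n * Real.log n) N - A * (r + 1) / (r + 2) * l ^ (r + 1 + 1)) +
      ∑ m ∈ Ico 1 N, F m / m * (logSum (fun _ => 1) ⌈(N:ℝ) / m⌉₊ - Real.log (N / m)) := by
    rw [e2]
    have hr : (r:ℝ) + 2 ≠ 0 := by positivity
    field_simp; ring
  rw [e3]
  refine (abs_add_le _ _).trans ((add_le_add ((abs_sub _ _).trans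
    (add_le_add_right (h2 N hN) _)) hE).trans ?_)
  rw [abs_mul, abs_of_nonneg hl0]
  have h8 : |logSum F N - A * l ^ (r + 1)| * l ≤ C₃ * (1 + l) ^ (r + 1) := by
    refine (mul_le_mul_of_nonneg_right (h3 N hN) hl0).trans ?_
    rw [← hl, pow_succ, ← mul_assoc]
    exact mul_le_mul_of_nonneg_left (by linarith) (by positivity)
  have h9 : C₁ * logSum F N ≤ C₁ * ((C₃ + |A|) * (1 + l) ^ (r + 1)) :=
    mul_le_mul_of_nonneg_left hS hC₁
  linarith

/-! ### Mertens' first theorem -/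

theorem ceil_natCast_div_bounds {N q : ℕ} (hq : 1 ≤ q) (hqN : q < N) :
    (N:ℝ) / q - 1 ≤ ((⌈(N:ℝ) / q⌉₊ - 1 : ℕ) : ℝ) ∧ ((⌈(N:ℝ) / q⌉₊ - 1 : ℕ) : ℝ) ≤ N / q := by
  have hq0 : (0:ℝ) < q := by exact_mod_cast hq
  have h0 : (0:ℝ) < N / q := div_pos (by exact_mod_cast (by omega : 0 < N)) hq0
  have h1 : 1 ≤ ⌈(N:ℝ) / q⌉₊ := Nat.one_le_ceil_iff.2 h0
  rw [Nat.cast_sub h1, Nat.cast_one]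
  exact ⟨by linarith [Nat.le_ceil ((N:ℝ) / q)], by linarith [Nat.ceil_lt_add_one h0.le]⟩

/-- Mertens' first theorem: `∑_{q < N} Λ(q) / q = log N + O(1)`. -/
theorem hasLogMean_vonMangoldt : HasLogMean Λ 1 0 := by
  refine ⟨Real.log 4 + 6, fun N hN => ?_⟩
  simp only [zero_add, pow_one, pow_zero, mul_one, one_mul]
  have hN0 : (0:ℝ) < N := by exact_mod_cast hN
  -- `log (N - 1)!` in two ways
  have e1 : ∑ n ∈ Ico 1 N, Real.log n =
      ∑ q ∈ Ico 1 N, Λ q * ((⌈(N:ℝ) / q⌉₊ - 1 : ℕ) : ℝ) := by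
    have := sum_Ico_divisorsAntidiagonal (N:ℝ) (fun z => Λ z.1)
    rw [Nat.ceil_natCast] at this
    simp only [Finset.sum_const, Nat.card_Ico, nsmul_eq_mul] at this
    rw [Finset.sum_congr rfl fun q _ => mul_comm (Λ q) _, ← this]
    refine Finset.sum_congr rfl fun n _ => ?_
    rw [Nat.sum_divisorsAntidiagonal fun m q : ℕ => Λ m, ArithmeticFunction.vonMangoldt_sum]
  have hup : ∑ n ∈ Ico 1 N, Real.log n ≤ N * logSum Λ N := by
    rw [e1, logSum, Finset.mul_sum]
    refine Finset.sum_le_sum fun q hq => ?_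
    have := (ceil_natCast_div_bounds (Finset.mem_Ico.1 hq).1 (Finset.mem_Ico.1 hq).2).2
    calc _ ≤ Λ q * (N / q) := mul_le_mul_of_nonneg_left this ArithmeticFunction.vonMangoldt_nonneg
      _ = _ := by ring
  have hlow : N * logSum Λ N - (Real.log 4 + 4) * N ≤ ∑ n ∈ Ico 1 N, Real.log n := by
    have h2 : ∑ q ∈ Ico 1 N, Λ q ≤ (Real.log 4 + 4) * N := by
      refine le_trans ?_ (Chebyshev.psi_le_const_mul_self hN0.le)
      rw [Chebyshev.psi, Nat.floor_natCast]
      refine Finset.sum_le_sum_of_subset_of_nonneg (fun q hq => ?_)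
        fun _ _ _ => ArithmeticFunction.vonMangoldt_nonneg
      simp only [Finset.mem_Ico, Finset.mem_Ioc] at hq ⊢; omega
    have h3 : N * logSum Λ N - ∑ q ∈ Ico 1 N, Λ q ≤ ∑ n ∈ Ico 1 N, Real.log n := by
      rw [e1, logSum, Finset.mul_sum, ← Finset.sum_sub_distrib]
      refine Finset.sum_le_sum fun q hq => ?_
      have := (ceil_natCast_div_bounds (Finset.mem_Ico.1 hq).1 (Finset.mem_Ico.1 hq).2).1
      calc _ = Λ q * (N / q - 1) := by ring
        _ ≤ _ := mul_le_mul_of_nonneg_left this ArithmeticFunction.vonMangoldt_nonneg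
    linarith
  have hfac : ∑ n ∈ Ico 1 N, Real.log n + Real.log N = Real.log N.factorial := by
    rw [← Finset.sum_Ico_succ_top hN (fun n => Real.log n), ← Finset.prod_Ico_id_eq_factorial,
      Nat.cast_prod, Real.log_prod]
    intro n hn
    have := (Finset.mem_Ico.1 hn).1
    exact_mod_cast (by omega : n ≠ 0)
  have hstir : N * Real.log N - N ≤ Real.log N.factorial := by
    have h4 := Real.pow_div_factorial_le_exp (x := (N:ℝ)) hN0.le N
    have hf : (0:ℝ) < N.factorial := by exact_mod_cast N.factorial_pos
    have h5 := Real.log_le_log (by positivity) h4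
    rw [Real.log_exp, Real.log_div (by positivity) hf.ne', Real.log_pow] at h5
    linarith
  have htriv : ∑ n ∈ Ico 1 N, Real.log n ≤ N * Real.log N := by
    calc _ ≤ ∑ n ∈ Ico 1 N, Real.log N := by
          refine Finset.sum_le_sum fun n hn => ?_
          have h := Finset.mem_Ico.1 hn
          exact Real.log_le_log (by exact_mod_cast h.1) (by exact_mod_cast h.2.le)
      _ = ((N - 1 : ℕ):ℝ) * Real.log N := by simp
      _ ≤ _ := mul_le_mul_of_nonneg_right (by exact_mod_cast Nat.sub_le N 1)
          (Real.log_natCast_nonneg N)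
  have hlogN : Real.log N ≤ N := (Real.log_le_sub_one_of_pos hN0).trans (by linarith)
  have h4 : 0 ≤ Real.log 4 := Real.log_nonneg (by norm_num)
  rw [abs_le]
  constructor
  · have : N * (Real.log N - 2) ≤ N * logSum Λ N := by linarith
    have := le_of_mul_le_mul_left this hN0
    linarith
  · have : N * logSum Λ N ≤ N * (Real.log N + (Real.log 4 + 4)) := by linarith
    have := le_of_mul_le_mul_left this hN0
    linarith

/-! ### The logarithmic mean of the square of the divisor function -/

/-- `μ²`, the indicator function of the squarefree numbers, in terms of square divisors. -/
theorem moebius_sq_eq_sum {N n : ℕ} (hn : 1 ≤ n) (hnN : n < N) :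
    (μ n : ℝ) ^ 2 = ∑ e ∈ Ico 1 N with e ^ 2 ∣ n, (μ e : ℝ) := by
  obtain ⟨a, b, rfl, ha⟩ := Nat.sq_mul_squarefree n
  have ha0 : 0 < a := Nat.pos_of_ne_zero ha.ne_zero
  have hb0 : 0 < b := Nat.pos_of_ne_zero (by rintro rfl; simp at hn)
  have hfil : (Ico 1 N).filter (fun e => e ^ 2 ∣ b ^ 2 * a) = b.divisors := by
    ext e
    simp only [Finset.mem_filter, Finset.mem_Ico, Nat.mem_divisors]
    constructor
    · rintro ⟨⟨he, -⟩, hdiv⟩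
      refine ⟨?_, hb0.ne'⟩
      -- remove the common factor of `e` and `b`; the rest of `e` has a square dividing `a`
      obtain ⟨g, e', b', hg, hco, rfl, rfl⟩ := Nat.exists_coprime' (Nat.gcd_pos_of_pos_left b he)
      have h1 : e' ^ 2 * g ^ 2 ∣ (b' ^ 2 * a) * g ^ 2 := by
        convert hdiv using 1 <;> ring
      have h2 : e' ^ 2 ∣ b' ^ 2 * a := Nat.dvd_of_mul_dvd_mul_right (by positivity) h1
      have h3 : e' ^ 2 ∣ a := (Nat.Coprime.pow 2 2 hco).dvd_of_dvd_mul_left h2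
      have h4 : e' = 1 := by
        have := ha e' (by rwa [← pow_two])
        exact Nat.isUnit_iff.1 this
      rw [h4, one_mul]; exact Dvd.intro_left b' rfl
    · rintro ⟨hdiv, -⟩
      have hle := Nat.le_of_dvd hb0 hdiv
      have he := Nat.pos_of_dvd_of_pos hdiv hb0
      refine ⟨⟨he, ?_⟩, (pow_dvd_pow_of_dvd hdiv 2).mul_right a⟩
      nlinarith [Nat.mul_le_mul hb0 ha0]
  rw [hfil]
  have h5 : ∑ e ∈ b.divisors, (μ e : ℝ) = if b = 1 then 1 else 0 := by
    have := congrArg (fun f : ArithmeticFunction ℤ => f b) ArithmeticFunction.moebius_mul_coe_zeta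
    simp only [ArithmeticFunction.coe_mul_zeta_apply, ArithmeticFunction.one_apply] at this
    exact_mod_cast this
  have h6 : (μ (b ^ 2 * a) : ℝ) ^ 2 = ((μ (b ^ 2 * a) ^ 2 : ℤ) : ℝ) := by push_cast; rfl
  rw [h5, h6, ArithmeticFunction.moebius_sq]
  by_cases hb : b = 1
  · subst hb; simp [ha]
  · rw [if_neg hb, if_neg]; · simp
    intro hsq
    have := hsq b (by exact ⟨a, by ring⟩)
    exact hb (Nat.isUnit_iff.1 this)

theorem abs_moebius_div_sq_le (e : ℕ) : |(μ e : ℝ) / (e:ℝ) ^ 2| ≤ 1 / (e:ℝ) ^ 2 := by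
  rw [abs_div, abs_of_nonneg (by positivity : (0:ℝ) ≤ (e:ℝ) ^ 2)]
  refine div_le_div_of_nonneg_right ?_ (by positivity)
  exact_mod_cast ArithmeticFunction.abs_moebius_le_one

theorem summable_moebius_div_sq : Summable fun e : ℕ => (μ e : ℝ) / (e:ℝ) ^ 2 :=
  Summable.of_norm_bounded (Real.summable_one_div_nat_pow.2 one_lt_two) abs_moebius_div_sq_le

theorem summable_log_div_sq : Summable fun e : ℕ => Real.log e / (e:ℝ) ^ 2 := by
  refine Summable.of_nonneg_of_le (fun e => div_nonneg (Real.log_natCast_nonneg e) (by positivity))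
    (fun e => ?_) ((Real.summable_nat_rpow_inv.2 (by norm_num : (1:ℝ) < 3 / 2)).mul_left 2)
  rcases Nat.eq_zero_or_pos e with rfl | he
  · simp
  have he0 : (0:ℝ) < e := by exact_mod_cast he
  have h := Real.log_le_rpow_div he0.le (by norm_num : (0:ℝ) < 1 / 2)
  rw [div_le_iff₀ (by positivity), mul_assoc, ← Real.rpow_neg he0.le, ← Real.rpow_natCast,
    ← Real.rpow_add he0]
  norm_num at h ⊢
  linarith

theorem tsum_moebius_div_sq_pos : 0 < ∑' e : ℕ, (μ e : ℝ) / (e:ℝ) ^ 2 := by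
  -- all terms of `∑ (μ(e) + 1) / e²` are nonnegative, the first is `2`, and `ζ(2) = π² / 6 < 2`
  have h2 := hasSum_zeta_two
  have h3 := summable_moebius_div_sq.hasSum.add h2
  have h4 : (2:ℝ) ≤ ∑' e : ℕ, (μ e : ℝ) / (e:ℝ) ^ 2 + Real.pi ^ 2 / 6 := by
    have := le_hasSum h3 1 fun e _ => by
      have := (abs_le.1 (abs_moebius_div_sq_le e)).1
      linarith
    norm_num at this
    exact this
  have := Real.pi_lt_d2
  have := Real.pi_pos
  nlinarith

/-- `∑_{n < N} μ(n)² / n = log N / ζ(2) + O(1)`. -/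
theorem exists_hasLogMean_moebius_sq : ∃ A, 0 < A ∧ HasLogMean (fun n => (μ n : ℝ) ^ 2) A 0 := by
  refine ⟨_, tsum_moebius_div_sq_pos, ?_⟩
  obtain ⟨C, hC0, hC⟩ := hasLogMean_one.real
  simp only [zero_add, pow_one, pow_zero, mul_one, one_mul] at hC
  have hsumC : Summable fun e : ℕ => C * (1 / (e:ℝ) ^ 2) + 2 * (Real.log e / (e:ℝ) ^ 2) :=
    ((Real.summable_one_div_nat_pow.2 one_lt_two).mul_left C).add (summable_log_div_sq.mul_left 2)
  refine ⟨∑' e : ℕ, (C * (1 / (e:ℝ) ^ 2) + 2 * (Real.log e / (e:ℝ) ^ 2)), fun N hN => ?_⟩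
  simp only [zero_add, pow_one, pow_zero, mul_one]
  have hN1 : (1:ℝ) ≤ N := by exact_mod_cast hN
  set H : ℕ → ℝ := fun e => logSum (fun _ => 1) ⌈(N:ℝ) / (e:ℝ) ^ 2⌉₊ with hH
  have e1 : logSum (fun n => (μ n : ℝ) ^ 2) N = ∑ e ∈ Ico 1 N, (μ e : ℝ) / (e:ℝ) ^ 2 * H e := by
    have : logSum (fun n => (μ n : ℝ) ^ 2) N =
        ∑ n ∈ Ico 1 N, ∑ e ∈ Ico 1 N, if e ^ 2 ∣ n then (μ e : ℝ) / n else 0 := by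
      refine Finset.sum_congr rfl fun n hn => ?_
      dsimp only
      rw [moebius_sq_eq_sum (Finset.mem_Ico.1 hn).1 (Finset.mem_Ico.1 hn).2, Finset.sum_div,
        Finset.sum_filter]
    rw [this, Finset.sum_comm]
    refine Finset.sum_congr rfl fun e he => ?_
    have he1 := (Finset.mem_Ico.1 he).1
    have he0 : (0:ℝ) < (e:ℝ) ^ 2 := by
      have : (0:ℝ) < e := by exact_mod_cast he1
      positivity
    rw [← Finset.sum_filter, hH]
    simp only [logSum, Finset.mul_sum]
    symm
    refine Finset.sum_nbij' (fun k => e ^ 2 * k) (fun n => n / e ^ 2) ?_ ?_ ?_ ?_ ?_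
    · intro k hk
      simp only [Finset.mem_Ico, Finset.mem_filter, Nat.lt_ceil] at hk ⊢
      rw [lt_div_iff₀ he0] at hk
      refine ⟨⟨Nat.mul_pos (by positivity) hk.1, ?_⟩, Dvd.intro _ rfl⟩
      have := hk.2
      have h : ((e ^ 2 * k : ℕ):ℝ) < N := by push_cast; linarith
      exact_mod_cast h
    · intro n hn
      simp only [Finset.mem_Ico, Finset.mem_filter, Nat.lt_ceil] at hn ⊢
      obtain ⟨⟨h1, h2⟩, k, rfl⟩ := hn
      rw [Nat.mul_div_cancel_left _ (by positivity), lt_div_iff₀ he0]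
      refine ⟨Nat.pos_of_mul_pos_left h1, ?_⟩
      have h : ((e ^ 2 * k : ℕ):ℝ) < N := by exact_mod_cast h2
      push_cast at h; linarith
    · intro k _
      exact Nat.mul_div_cancel_left _ (by positivity)
    · intro n hn
      exact Nat.mul_div_cancel' (Finset.mem_filter.1 hn).2
    · intro k hk
      have : (k:ℝ) ≠ 0 := by
        have := (Finset.mem_Ico.1 hk).1
        exact_mod_cast (by omega : k ≠ 0)
      push_cast
      field_simp
  have hzero : ∀ e ∉ Ico 1 N, (μ e : ℝ) / (e:ℝ) ^ 2 * H e = 0 := by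
    intro e he
    rcases Nat.eq_zero_or_pos e with rfl | h0
    · simp
    have heN : N ≤ e := by
      by_contra h; exact he (Finset.mem_Ico.2 ⟨h0, by omega⟩)
    have : ⌈(N:ℝ) / (e:ℝ) ^ 2⌉₊ ≤ 1 := by
      rw [Nat.ceil_le, div_le_iff₀ (by positivity)]
      exact_mod_cast (by nlinarith : N ≤ 1 * e ^ 2)
    rw [hH]; simp [logSum, Finset.Ico_eq_empty_of_le this]
  have hbound : ∀ e : ℕ, ‖(μ e : ℝ) / (e:ℝ) ^ 2 * H e - (μ e : ℝ) / (e:ℝ) ^ 2 * Real.log N‖ ≤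
      C * (1 / (e:ℝ) ^ 2) + 2 * (Real.log e / (e:ℝ) ^ 2) := by
    intro e
    rcases Nat.eq_zero_or_pos e with rfl | h0
    · simp
    have he0 : (0:ℝ) < e := by exact_mod_cast h0
    have hle : 0 ≤ Real.log e := Real.log_natCast_nonneg e
    -- for `e² > N` the sum `H e` is empty, while `log N < 2 log e`
    have hm : |H e - Real.log N| ≤ C + 2 * Real.log e := by
      by_cases h : 1 ≤ (N:ℝ) / (e:ℝ) ^ 2
      · have h1 := hC _ h
        rw [Real.log_div (by positivity) (by positivity), Real.log_pow] at h1
        rw [abs_le] at h1 ⊢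
        push_cast at h1
        constructor <;> linarith [h1.1, h1.2]
      · have h' : ⌈(N:ℝ) / (e:ℝ) ^ 2⌉₊ ≤ 1 := by rw [Nat.ceil_le]; push_cast; linarith
        have hHe : H e = 0 := by rw [hH]; simp [logSum, Finset.Ico_eq_empty_of_le h']
        rw [not_le, div_lt_one (by positivity)] at h
        have h2 := Real.log_le_log (by linarith) h.le
        rw [Real.log_pow] at h2
        push_cast at h2
        rw [hHe, zero_sub, abs_neg, abs_of_nonneg (Real.log_nonneg hN1)]
        linarith
    rw [← mul_sub, Real.norm_eq_abs, abs_mul]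
    calc _ ≤ 1 / (e:ℝ) ^ 2 * (C + 2 * Real.log e) :=
          mul_le_mul (abs_moebius_div_sq_le e) hm (abs_nonneg _) (by positivity)
      _ = _ := by ring
  have e2 : logSum (fun n => (μ n : ℝ) ^ 2) N - (∑' e : ℕ, (μ e : ℝ) / (e:ℝ) ^ 2) * Real.log N =
      ∑' e : ℕ, ((μ e : ℝ) / (e:ℝ) ^ 2 * H e - (μ e : ℝ) / (e:ℝ) ^ 2 * Real.log N) := by
    rw [e1, ← tsum_mul_right]
    have hs : HasSum (fun e : ℕ => (μ e : ℝ) / (e:ℝ) ^ 2 * H e) _ :=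
      hasSum_sum_of_ne_finset_zero hzero
    rw [(hs.sub (summable_moebius_div_sq.mul_right (Real.log N)).hasSum).tsum_eq]
  rw [e2]
  exact tsum_of_norm_bounded hsumC.hasSum hbound

/-- The Dirichlet series identity `∑ d(n)² n⁻ˢ = ζ(s)⁴ / ζ(2s)`, as the convolution identity
`d² = μ² * 1 * 1 * 1`. -/
theorem sq_d_eq (n : ℕ) : ((d n : ℕ) : ℝ) ^ 2 =
    ∑ a ∈ n.divisors, ∑ b ∈ a.divisors, ∑ c ∈ b.divisors, (μ c : ℝ) ^ 2 := by
  have key : ((ArithmeticFunction.sigma 0).pmul (ArithmeticFunction.sigma 0) :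
      ArithmeticFunction ℤ) = ArithmeticFunction.pmul μ μ * ζ * ζ * ζ := by
    have hσ := (ArithmeticFunction.isMultiplicative_sigma (k := 0))
    have hμ := ArithmeticFunction.isMultiplicative_moebius
    have hζ := (ArithmeticFunction.isMultiplicative_zeta.natCast (R := ℤ))
    rw [ArithmeticFunction.IsMultiplicative.eq_iff_eq_on_prime_powers _ (hσ.pmul hσ).natCast _
      ((((hμ.pmul hμ).mul hζ).mul hζ).mul hζ)]
    intro p i hp
    have h1 : ∀ i : ℕ, (ArithmeticFunction.pmul μ μ * ζ : ArithmeticFunction ℤ) (p ^ i) = if i = 0 then 1 else 2 := by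
      intro i
      rw [ArithmeticFunction.coe_mul_zeta_apply, Nat.sum_divisors_prime_pow hp]
      induction i with
      | zero => simp
      | succ i ih =>
        rw [Finset.sum_range_succ, ih]
        simp only [ArithmeticFunction.pmul_apply,
          ArithmeticFunction.moebius_apply_prime_pow hp i.succ_ne_zero]
        rcases i with _ | i <;> simp
    have h2 : ∀ i : ℕ, (ArithmeticFunction.pmul μ μ * ζ * ζ : ArithmeticFunction ℤ) (p ^ i) = 2 * i + 1 := by
      intro i
      rw [ArithmeticFunction.coe_mul_zeta_apply, Nat.sum_divisors_prime_pow hp]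
      induction i with
      | zero => simp [h1]
      | succ i ih =>
        rw [Finset.sum_range_succ, ih, h1]
        simp only [Nat.succ_ne_zero, if_false]
        push_cast; ring
    have h3 : ∀ i : ℕ, (ArithmeticFunction.pmul μ μ * ζ * ζ * ζ : ArithmeticFunction ℤ) (p ^ i) = (i + 1) ^ 2 := by
      intro i
      rw [ArithmeticFunction.coe_mul_zeta_apply, Nat.sum_divisors_prime_pow hp]
      induction i with
      | zero => simp [h2]
      | succ i ih =>
        rw [Finset.sum_range_succ, ih, h2]
        push_cast; ring
    rw [h3, ArithmeticFunction.natCoe_apply, ArithmeticFunction.pmul_apply,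
      ArithmeticFunction.sigma_zero_apply_prime_pow hp]
    push_cast; ring
  have := congrArg (fun f : ArithmeticFunction ℤ => f n) key
  simp only [ArithmeticFunction.coe_mul_zeta_apply, ArithmeticFunction.natCoe_apply,
    ArithmeticFunction.pmul_apply, ArithmeticFunction.sigma_zero_apply] at this
  have h : ((n.divisors.card * n.divisors.card : ℕ) : ℤ) = ∑ a ∈ n.divisors, ∑ b ∈ a.divisors,
    ∑ c ∈ b.divisors, μ c ^ 2 := by rw [this]; simp only [pow_two]
  have h' : (((n.divisors.card * n.divisors.card : ℕ) : ℤ) : ℝ) = _ := congrArg _ h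
  rw [d, pow_two]
  push_cast at h' ⊢
  exact h'

/-- `∑_{n < N} d(n)² / n = A log⁴ N + O(log³ N)` with a positive constant `A`. -/
theorem exists_hasLogMean_sq_d : ∃ A, 0 < A ∧ HasLogMean (fun n => ((d n : ℕ) : ℝ) ^ 2) A 3 := by
  obtain ⟨A, hA, h⟩ := exists_hasLogMean_moebius_sq
  have h1 := h.sum_divisors fun n => sq_nonneg _
  have h2 := h1.sum_divisors fun n => Finset.sum_nonneg fun _ _ => sq_nonneg _
  have h3 := h2.sum_divisors fun n => Finset.sum_nonneg fun _ _ => Finset.sum_nonneg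
    fun _ _ => sq_nonneg _
  simp_rw [← sq_d_eq] at h3
  exact ⟨_, by positivity, h3⟩

/-! ### Arithmetic of the coefficients -/

/-- The coefficients `λ(m) d(m)`. -/
noncomputable def liouvilleD (m : ℕ) : ℝ := (ArithmeticFunction.liouville m : ℝ) * (d m : ℝ)

/-- The coefficients `-(2 / log T) Λ(q) (1 - log q / log T)`; the sequence `b T` is the Dirichlet
convolution of the truncations of `liouvilleD` and `smoothMangoldt T`. -/
noncomputable def smoothMangoldt (T : ℝ) (q : ℕ) : ℝ :=
  -(2 / Real.log T) * (Λ q * (1 - Real.log q / Real.log T))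

theorem b_eq_sum (T : ℝ) (n : ℕ) : b T n =
    ∑ z ∈ n.divisorsAntidiagonal with (z.1 : ℝ) < cutoff T ∧ (z.2 : ℝ) < T,
      liouvilleD z.1 * smoothMangoldt T z.2 := by
  rw [b, Finset.mul_sum]
  refine Finset.sum_congr rfl fun z _ => ?_
  rw [liouvilleD, smoothMangoldt]; ring

theorem liouville_mul_self {n : ℕ} (hn : n ≠ 0) :
    (ArithmeticFunction.liouville n : ℝ) * ArithmeticFunction.liouville n = 1 := by
  rw [ArithmeticFunction.liouville_apply hn]
  push_cast
  rw [← mul_pow]; simp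

theorem abs_liouville {n : ℕ} (hn : n ≠ 0) : |(ArithmeticFunction.liouville n : ℝ)| = 1 := by
  rw [ArithmeticFunction.liouville_apply hn]
  push_cast
  simp

theorem abs_liouvilleD (n : ℕ) : |liouvilleD n| = d n := by
  rcases eq_or_ne n 0 with rfl | hn
  · simp [liouvilleD, d]
  · rw [liouvilleD, abs_mul, abs_liouville hn, one_mul, abs_of_nonneg (Nat.cast_nonneg _)]

theorem d_le_d_mul {m q : ℕ} (hq : q ≠ 0) : d m ≤ d (m * q) := by
  rcases eq_or_ne m 0 with rfl | hm
  · simp [d]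
  · exact Finset.card_le_card (Nat.divisors_subset_of_dvd (mul_ne_zero hm hq) (dvd_mul_right m q))

theorem d_mul_le (m q : ℕ) : d (m * q) ≤ d m * d q := by
  classical
  unfold d
  rw [Nat.divisors_mul]
  exact Finset.card_mul_le

theorem d_mul_prime {n p : ℕ} (hp : p.Prime) (hn : ¬ p ∣ n) : d (n * p) = 2 * d n := by
  unfold d
  rw [((Nat.Prime.coprime_iff_not_dvd hp).2 hn).symm.card_divisors_mul, hp.divisors,
    Finset.card_pair hp.one_lt.ne]
  ring

theorem d_le_self (n : ℕ) : d n ≤ n := Nat.card_divisors_le_self n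

/-- `Λ * d = (d log) / 2`, the coefficient form of `ζ' ζ = (ζ²)' / 2`. -/
theorem sum_vonMangoldt_mul_d (n : ℕ) :
    ∑ z ∈ n.divisorsAntidiagonal, Λ z.2 * (d z.1 : ℝ) = d n * Real.log n / 2 := by
  have h1 : ∑ z ∈ n.divisorsAntidiagonal, Λ z.2 * (d z.1 : ℝ) = ∑ e ∈ n.divisors, Real.log e := by
    have := congrArg (fun f : ArithmeticFunction ℝ => f n)
      (show ((ζ : ArithmeticFunction ℝ) * ζ) * Λ = ζ * ArithmeticFunction.log by
        rw [mul_assoc, ArithmeticFunction.zeta_mul_vonMangoldt])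
    simp only [ArithmeticFunction.coe_zeta_mul_apply, ArithmeticFunction.log_apply] at this
    rw [← this, ArithmeticFunction.mul_apply]
    refine Finset.sum_congr rfl fun z hz => ?_
    rw [mul_comm, ArithmeticFunction.coe_zeta_mul_apply]
    congr 1
    rw [d, Finset.card_eq_sum_ones, Nat.cast_sum]
    refine Finset.sum_congr rfl fun e he => ?_
    rw [ArithmeticFunction.natCoe_apply,
      ArithmeticFunction.zeta_apply_ne (Nat.pos_of_mem_divisors he).ne']
  have h2 : ∑ e ∈ n.divisors, Real.log e + ∑ e ∈ n.divisors, Real.log (n / e : ℕ) =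
      d n * Real.log n := by
    rw [← Finset.sum_add_distrib, Finset.sum_congr rfl (g := fun _ => Real.log n)]
    · rw [Finset.sum_const, nsmul_eq_mul, d]
    · intro e he
      have he0 : (e:ℝ) ≠ 0 := by exact_mod_cast (Nat.pos_of_mem_divisors he).ne'
      have hn0 : (n:ℝ) ≠ 0 := by exact_mod_cast (Nat.mem_divisors.1 he).2
      rw [Nat.cast_div (Nat.dvd_of_mem_divisors he) he0, Real.log_div hn0 he0]
      ring
  rw [Nat.sum_div_divisors n (fun e => Real.log (e:ℕ))] at h2
  rw [h1]; linarith

/-- Pointwise bound for the coefficients of the head. The sum that is subtracted comes from the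
smooth weight `1 - log q / log T`. -/
theorem sq_b_le {T : ℝ} (hL : 0 < Real.log T) {n : ℕ} (hnT : (n:ℝ) ≤ T) :
    b T n ^ 2 ≤ (d n * Real.log n / Real.log T) ^ 2 - 2 / Real.log T ^ 3 *
      ∑ z ∈ n.divisorsAntidiagonal, Λ z.2 * Real.log z.2 * ((d z.1 : ℝ) ^ 2 * Real.log z.1) := by
  set L := Real.log T with hLdef
  set X := d n * Real.log n / L with hX
  set h := ∑ z ∈ n.divisorsAntidiagonal, 2 / L * (Λ z.2 * (1 - Real.log z.2 / L) * d z.1) with hh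
  have hmem : ∀ z ∈ n.divisorsAntidiagonal, 1 ≤ z.1 ∧ 1 ≤ z.2 ∧ z.1 * z.2 = n := by
    intro z hz
    obtain ⟨h1, h2⟩ := Nat.mem_divisorsAntidiagonal.1 hz
    refine ⟨?_, ?_, h1⟩
    · exact Nat.pos_of_ne_zero fun h => by rw [h, zero_mul] at h1; exact h2 h1.symm
    · exact Nat.pos_of_ne_zero fun h => by rw [h, mul_zero] at h1; exact h2 h1.symm
  have hw : ∀ z ∈ n.divisorsAntidiagonal, 0 ≤ 1 - Real.log z.2 / L := by
    intro z hz
    obtain ⟨h1, h2, h3⟩ := hmem z hz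
    rw [sub_nonneg, div_le_one hL]
    refine Real.log_le_log (by exact_mod_cast h2) (le_trans ?_ hnT)
    rw [← h3]; exact_mod_cast Nat.le_mul_of_pos_left z.2 h1
  have hΛ : ∀ k : ℕ, 0 ≤ Λ k := fun k => ArithmeticFunction.vonMangoldt_nonneg
  have hterm : ∀ z ∈ n.divisorsAntidiagonal,
      0 ≤ 2 / L * (Λ z.2 * (1 - Real.log z.2 / L) * d z.1) := fun z hz => by
    have := hw z hz; have := hΛ z.2; positivity
  have hh0 : 0 ≤ h := Finset.sum_nonneg hterm
  -- `h ≤ X` because `Λ * d = (d log) / 2`; so `b² ≤ h² ≤ X h`, which is linear in the savings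
  have hb : |b T n| ≤ h := by
    rw [b_eq_sum]
    refine (Finset.abs_sum_le_sum_abs _ _).trans ((Finset.sum_le_sum fun z hz => ?_).trans
      (Finset.sum_le_sum_of_subset_of_nonneg (Finset.filter_subset _ _) fun z hz _ => hterm z hz))
    have hz' := Finset.mem_of_mem_filter z hz
    rw [abs_mul, abs_liouvilleD, smoothMangoldt, abs_mul, abs_neg, ← hLdef,
      abs_of_nonneg (by positivity : 0 ≤ 2 / L), abs_of_nonneg (mul_nonneg (hΛ _) (hw z hz'))]
    exact le_of_eq (by ring)
  have hsplit : h = X - 2 / L ^ 2 *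
      ∑ z ∈ n.divisorsAntidiagonal, Λ z.2 * Real.log z.2 * d z.1 := by
    have : X = 2 / L * ∑ z ∈ n.divisorsAntidiagonal, Λ z.2 * (d z.1 : ℝ) := by
      rw [sum_vonMangoldt_mul_d, hX]; field_simp
    rw [this, hh, Finset.mul_sum, Finset.mul_sum, ← Finset.sum_sub_distrib]
    refine Finset.sum_congr rfl fun z _ => ?_
    field_simp
  have hX0 : 0 ≤ X := by have := Real.log_natCast_nonneg n; positivity
  have hlogs : ∀ k : ℕ, 0 ≤ Real.log k := fun k => Real.log_natCast_nonneg k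
  have hhX : h ≤ X := by
    rw [hsplit, sub_le_self_iff]
    refine mul_nonneg (by positivity) (Finset.sum_nonneg fun z _ => ?_)
    have := hΛ z.2; have := hlogs z.2; positivity
  calc b T n ^ 2 ≤ h ^ 2 := by rw [← sq_abs]; exact pow_le_pow_left₀ (abs_nonneg _) hb 2
    _ ≤ X * h := by rw [pow_two]; exact mul_le_mul_of_nonneg_right hhX hh0
    _ = X ^ 2 - 2 / L ^ 3 * ∑ z ∈ n.divisorsAntidiagonal,
          Λ z.2 * Real.log z.2 * ((d z.1 * d n : ℝ) * Real.log n) := by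
        have : ∑ z ∈ n.divisorsAntidiagonal,
            Λ z.2 * Real.log z.2 * ((d z.1 * d n : ℝ) * Real.log n) = d n * Real.log n *
            ∑ z ∈ n.divisorsAntidiagonal, Λ z.2 * Real.log z.2 * d z.1 := by
          rw [Finset.mul_sum]; exact Finset.sum_congr rfl fun z _ => by ring
        rw [this, hsplit, hX]; field_simp
    _ ≤ _ := by
        refine sub_le_sub_left (mul_le_mul_of_nonneg_left (Finset.sum_le_sum fun z hz => ?_)
          (by positivity)) _
        obtain ⟨h1, h2, h3⟩ := hmem z hz
        refine mul_le_mul_of_nonneg_left ?_ (mul_nonneg (hΛ _) (hlogs _))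
        have h4 : (d z.1 : ℝ) ≤ d n := by
          rw [← h3]; exact_mod_cast d_le_d_mul (Nat.pos_iff_ne_zero.1 h2)
        have h5 : Real.log z.1 ≤ Real.log n := by
          refine Real.log_le_log (by exact_mod_cast h1) ?_
          rw [← h3]; exact_mod_cast Nat.le_mul_of_pos_right z.1 h2
        rw [pow_two]
        exact mul_le_mul (mul_le_mul_of_nonneg_left h4 (Nat.cast_nonneg _)) h5 (hlogs _)
          (by positivity)

/-- Prime powers that are not prime contribute a bounded amount. -/
theorem exists_sum_nonprime_le : ∃ K : ℝ, 0 ≤ K ∧ ∀ s : Finset ℕ,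
    ∑ q ∈ s, (if q.Prime then 0 else Λ q * (d q + 2) / q) ≤ K := by
  set G : ℕ × ℕ → ℝ := fun z => (10 * ((z.1:ℝ) ^ (3 / 2 : ℝ))⁻¹) * (3 / 4 : ℝ) ^ z.2 with hG
  have hG0 : ∀ z, 0 ≤ G z := fun z => by positivity
  have hGs : Summable G := by
    have h1 : Summable fun p : ℕ => 10 * ((p:ℝ) ^ (3 / 2 : ℝ))⁻¹ :=
      (Real.summable_nat_rpow_inv.2 (by norm_num)).mul_left 10
    have h2 : Summable fun i : ℕ => (3 / 4 : ℝ) ^ i :=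
      summable_geometric_of_lt_one (by norm_num) (by norm_num)
    exact h1.mul_of_nonneg h2 (fun _ => by positivity) fun _ => by positivity
  refine ⟨∑' z, G z, tsum_nonneg hG0, fun s => ?_⟩
  classical
  -- the prime power `p^(i+2)` is compared with `G (p, i)`
  set φ : ℕ → ℕ × ℕ := fun q => (q.minFac, q.factorization q.minFac - 2) with hφ
  have hpp : ∀ q : ℕ, IsPrimePow q → ¬ q.Prime →
      ∃ i, q.factorization q.minFac = i + 2 ∧ q = q.minFac ^ (i + 2) ∧ q.minFac.Prime := by
    intro q hq hnp
    have hmf := hq.minFac_pow_factorization_eq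
    have hpr : q.minFac.Prime := Nat.minFac_prime hq.ne_one
    obtain ⟨j, hj⟩ : ∃ j, q.factorization q.minFac = j := ⟨_, rfl⟩
    rw [hj] at hmf
    rcases j with _ | _ | i
    · exact absurd (by simpa using hmf.symm) hq.ne_one
    · exact absurd (by rw [← hmf]; simpa using hpr) hnp
    · exact ⟨i, hj, hmf.symm, hpr⟩
  rw [← Finset.sum_filter_add_sum_filter_not s (fun q => IsPrimePow q ∧ ¬ q.Prime),
    Finset.sum_eq_zero (s := s.filter fun q => ¬ (IsPrimePow q ∧ ¬ q.Prime)), add_zero]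
  · calc _ ≤ ∑ q ∈ s with (IsPrimePow q ∧ ¬ q.Prime), G (φ q) := by
          refine Finset.sum_le_sum fun q hq => ?_
          obtain ⟨hq1, hq2⟩ := (Finset.mem_filter.1 hq).2
          obtain ⟨i, hi, hqi, hpr⟩ := hpp q hq1 hq2
          rw [if_neg hq2]
          have hφq : φ q = (q.minFac, i) := by rw [hφ]; simp [hi]
          rw [hφq]
          set p := q.minFac
          have hp0 : (0:ℝ) < p := by exact_mod_cast hpr.pos
          have hp2 : (2:ℝ) ≤ p := by exact_mod_cast hpr.two_le
          rw [hqi, ArithmeticFunction.vonMangoldt_apply_pow (by omega),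
            ArithmeticFunction.vonMangoldt_apply_prime hpr, d, Nat.divisors_prime_pow hpr,
            Finset.card_map, Finset.card_range]
          push_cast
          have h1 : Real.log p ≤ 2 * (p:ℝ) ^ (1 / 2 : ℝ) := by
            have := Real.log_le_rpow_div hp0.le (by norm_num : (0:ℝ) < 1 / 2)
            linarith
          have h2 : ((i:ℝ) + 2 + 1 + 2) ≤ 5 * (3 / 2) ^ i := by
            have := one_add_mul_le_pow (a := (1 / 2 : ℝ)) (by norm_num) i
            norm_num at this
            have hi0 : (0:ℝ) ≤ i := Nat.cast_nonneg i
            linarith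
          have h3 : (2:ℝ) ^ i ≤ (p:ℝ) ^ i := pow_le_pow_left₀ (by norm_num) hp2 i
          have h4 : (p:ℝ) ^ (1 / 2 : ℝ) * (p:ℝ) ^ (3 / 2 : ℝ) = (p:ℝ) ^ 2 := by
            rw [← Real.rpow_add hp0, ← Real.rpow_natCast]; norm_num
          rw [div_le_iff₀ (by positivity), hG]
          dsimp only
          have h5 : (3 / 4 : ℝ) ^ i * 2 ^ i = (3 / 2) ^ i := by rw [← mul_pow]; norm_num
          calc Real.log p * ((i:ℝ) + 2 + 1 + 2)
              ≤ (2 * (p:ℝ) ^ (1 / 2 : ℝ)) * (5 * (3 / 2) ^ i) := by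
                refine mul_le_mul h1 h2 (by positivity) (by positivity)
            _ = 10 * ((p:ℝ) ^ (3 / 2 : ℝ))⁻¹ * (3 / 4) ^ i * (p ^ 2 * 2 ^ i) := by
                rw [← h5, ← h4]; field_simp; ring
            _ ≤ _ := by
                rw [pow_add, mul_comm ((p:ℝ) ^ i)]
                gcongr
      _ = ∑ z ∈ (s.filter fun q => IsPrimePow q ∧ ¬ q.Prime).image φ, G z := by
          rw [Finset.sum_image]
          intro q hq q' hq' he
          obtain ⟨hq1, hq2⟩ := (Finset.mem_filter.1 hq).2
          obtain ⟨hq1', hq2'⟩ := (Finset.mem_filter.1 hq').2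
          obtain ⟨i, hi, hqi, -⟩ := hpp q hq1 hq2
          obtain ⟨i', hi', hqi', -⟩ := hpp q' hq1' hq2'
          simp only [hφ, hi, hi', Prod.mk.injEq] at he
          rw [hqi, hqi', he.1, show i = i' by omega]
      _ ≤ _ := hGs.sum_le_tsum _ fun z _ => hG0 z
  · intro q hq
    have := (Finset.mem_filter.1 hq).2
    by_cases hp : q.Prime
    · rw [if_pos hp]
    · rw [if_neg hp, ArithmeticFunction.vonMangoldt_eq_zero_iff.2 fun h => this ⟨h, hp⟩]; simp

theorem sum_log_primeFactors_le {n : ℕ} (hn : 1 ≤ n) :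
    ∑ p ∈ n.primeFactors, Real.log p ≤ Real.log n := by
  rw [← Real.log_prod fun p hp => by exact_mod_cast (Nat.prime_of_mem_primeFactors hp).ne_zero]
  rw [← Nat.cast_prod]
  refine Real.log_le_log ?_ (by exact_mod_cast Nat.le_of_dvd hn (Nat.prod_primeFactors_dvd n))
  exact_mod_cast Finset.prod_pos fun p hp => (Nat.prime_of_mem_primeFactors hp).pos

/-- Splitting the primes at `√log n` bounds `∑_{p ∣ n} log p / p`. -/
theorem sum_log_div_primeFactors_le {n : ℕ} (hn : 1 ≤ n) :
    ∑ p ∈ n.primeFactors, Real.log p / p ≤ 2 * √(Real.log n) := by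
  rcases Nat.eq_or_lt_of_le hn with rfl | hn1
  · simp
  have hl : 0 < Real.log n := Real.log_pos (by exact_mod_cast hn1)
  set Z := √(Real.log n) with hZ
  have hZ0 : 0 < Z := Real.sqrt_pos.2 hl
  have h1 : ∑ p ∈ n.primeFactors with ((p:ℕ):ℝ) ≤ Z, Real.log p / p ≤ Z := by
    calc _ ≤ ∑ p ∈ n.primeFactors with ((p:ℕ):ℝ) ≤ Z, (1:ℝ) := by
          refine Finset.sum_le_sum fun p hp => ?_
          have hp0 : (0:ℝ) < p := by
            exact_mod_cast (Nat.prime_of_mem_primeFactors (Finset.mem_of_mem_filter p hp)).pos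
          rw [div_le_one hp0]
          linarith [Real.log_le_sub_one_of_pos hp0]
      _ = ((n.primeFactors.filter fun p : ℕ => (p:ℝ) ≤ Z).card : ℝ) := by simp
      _ ≤ ((Icc 1 ⌊Z⌋₊).card : ℝ) := by
          refine Nat.cast_le.2 (Finset.card_le_card fun p hp => ?_)
          rw [Finset.mem_filter] at hp
          exact Finset.mem_Icc.2 ⟨(Nat.prime_of_mem_primeFactors hp.1).pos, Nat.le_floor hp.2⟩
      _ ≤ Z := by simpa using Nat.floor_le hZ0.le
  have h2 : ∑ p ∈ n.primeFactors with ¬ ((p:ℕ):ℝ) ≤ Z, Real.log p / p ≤ Z := by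
    calc _ ≤ ∑ p ∈ n.primeFactors with ¬ ((p:ℕ):ℝ) ≤ Z, Real.log p / Z := by
          refine Finset.sum_le_sum fun p hp => ?_
          rw [Finset.mem_filter, not_le] at hp
          exact div_le_div_of_nonneg_left (Real.log_natCast_nonneg p) hZ0 hp.2.le
      _ ≤ ∑ p ∈ n.primeFactors, Real.log p / Z :=
          Finset.sum_le_sum_of_subset_of_nonneg (Finset.filter_subset _ _)
            fun p _ _ => div_nonneg (Real.log_natCast_nonneg p) hZ0.le
      _ ≤ Real.log n / Z := by
          rw [← Finset.sum_div]
          exact div_le_div_of_nonneg_right (sum_log_primeFactors_le hn) hZ0.le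
      _ = Z := by rw [hZ, Real.div_sqrt]
  rw [← Finset.sum_filter_add_sum_filter_not n.primeFactors (fun p : ℕ => (p:ℝ) ≤ Z)]
  linarith

/-- The coefficient of `n^(-1/2-it)` in the projection of `A(t) · conj (Y(t))`:
`∑_{n q < x} λ(nq) d(nq) y(q) / q`, where `y` is `smoothMangoldt T` and `x = cutoff T`. -/
noncomputable def corrCoeff (T : ℝ) (n : ℕ) : ℝ :=
  ∑ q ∈ Ico 1 ⌈cutoff T / n⌉₊, liouvilleD (n * q) * smoothMangoldt T q / q

/-- The factor `-λ(q) d(nq)` is at least `2 d(n)` for primes `q ∤ n`; the indicator terms bound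
the loss for the other prime powers. -/
theorem neg_liouville_mul_d_ge {n q : ℕ} (hq : IsPrimePow q) :
    (d n : ℝ) * (2 - (if q.Prime ∧ q ∣ n then 1 else 0) - (if q.Prime then 0 else (d q + 2 : ℝ))) ≤
      -(ArithmeticFunction.liouville q : ℝ) * d (n * q) := by
  by_cases hp : q.Prime
  · have hlam : (ArithmeticFunction.liouville q : ℝ) = -1 := by
      rw [ArithmeticFunction.liouville_apply hp.ne_zero,
        ArithmeticFunction.cardFactors_apply_prime hp]
      simp
    rw [hlam, if_pos hp]
    by_cases hdvd : q ∣ n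
    · rw [if_pos ⟨hp, hdvd⟩]
      have : (d n : ℝ) ≤ d (n * q) := by exact_mod_cast d_le_d_mul hp.ne_zero
      linarith
    · rw [if_neg fun h => hdvd h.2, d_mul_prime hp hdvd]
      push_cast; linarith
  · rw [if_neg hp, if_neg fun h => hp h.1]
    have h1 : (d (n * q) : ℝ) ≤ d n * d q := by exact_mod_cast d_mul_le n q
    have h2 := (abs_le.1 (abs_liouville hq.ne_zero).le).2
    have h3 : (ArithmeticFunction.liouville q : ℝ) * d (n * q) ≤ 1 * d (n * q) :=
      mul_le_mul_of_nonneg_right h2 (Nat.cast_nonneg _)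
    linarith

/-- Since `λ(p) d(p) = -2`, the coefficients `corrCoeff` all have the sign of `λ(n)`, up to small
errors from the primes dividing `n` and from proper prime powers. -/
theorem liouville_mul_corrCoeff_ge {K : ℝ} (hK : ∀ s : Finset ℕ,
    ∑ q ∈ s, (if q.Prime then 0 else Λ q * (d q + 2) / q) ≤ K) {T : ℝ} (hL : 0 < Real.log T)
    {n : ℕ} (hn : 1 ≤ n) (hT : cutoff T ≤ T) :
    d n * (2 / Real.log T * (2 * ∑ q ∈ Ico 1 ⌈cutoff T / n⌉₊,
        Λ q * (1 - Real.log q / Real.log T) / q - ∑ p ∈ n.primeFactors, Real.log p / p - K)) ≤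
      (ArithmeticFunction.liouville n : ℝ) * corrCoeff T n := by
  set L := Real.log T with hLdef
  set s := Ico 1 ⌈cutoff T / n⌉₊ with hs
  have hn0 : n ≠ 0 := by omega
  have hn1 : (1:ℝ) ≤ n := by exact_mod_cast hn
  have hΛ : ∀ k : ℕ, 0 ≤ Λ k := fun k => ArithmeticFunction.vonMangoldt_nonneg
  have hw : ∀ q ∈ s, 0 ≤ 1 - Real.log q / L ∧ 1 - Real.log q / L ≤ 1 := by
    intro q hq
    rw [hs, Finset.mem_Ico, Nat.lt_ceil, lt_div_iff₀ (by linarith)] at hq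
    have hq0 : (0:ℝ) < q := by exact_mod_cast hq.1
    refine ⟨?_, by have := Real.log_natCast_nonneg q; rw [sub_le_self_iff]; positivity⟩
    rw [sub_nonneg, div_le_one hL]
    exact Real.log_le_log hq0 (by nlinarith)
  have hterm : ∀ q ∈ s, d n * (2 / L * (2 * (Λ q * (1 - Real.log q / L) / q) -
      (if q.Prime ∧ q ∣ n then Real.log q / q else 0) -
      (if q.Prime then 0 else Λ q * (d q + 2) / q))) ≤
      (ArithmeticFunction.liouville n : ℝ) * (liouvilleD (n * q) * smoothMangoldt T q / q) := by
    intro q hq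
    obtain ⟨hw0, hw1⟩ := hw q hq
    have hq0 : (0:ℝ) < q := by exact_mod_cast (Finset.mem_Ico.1 hq).1
    by_cases hpp : IsPrimePow q
    swap
    · rw [smoothMangoldt, ArithmeticFunction.vonMangoldt_eq_zero_iff.2 hpp,
        if_neg fun h => hpp h.1.isPrimePow]
      simp
    have e : (ArithmeticFunction.liouville n : ℝ) *
        (liouvilleD (n * q) * smoothMangoldt T q / q) =
        (-(ArithmeticFunction.liouville q : ℝ) * d (n * q)) *
          (2 / L * (Λ q * (1 - Real.log q / L) / q)) := by
      rw [liouvilleD, smoothMangoldt, ArithmeticFunction.liouville_apply_mul, ← hLdef]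
      push_cast
      linear_combination (-(2 / L) * Λ q * (1 - Real.log q / L) / q *
        ArithmeticFunction.liouville q * d (n * q)) * liouville_mul_self hn0
    rw [e]
    have hM : 0 ≤ 2 / L * (Λ q * (1 - Real.log q / L) / q) := by
      have := hΛ q; positivity
    refine le_trans ?_ (mul_le_mul_of_nonneg_right (neg_liouville_mul_d_ge hpp) hM)
    have hx : Λ q * (1 - Real.log q / L) / q ≤ Λ q / q :=
      div_le_div_of_nonneg_right (mul_le_of_le_one_right (hΛ q) hw1) hq0.le
    set M := Λ q * (1 - Real.log q / L) / q
    have hM' : 0 ≤ M := div_nonneg (mul_nonneg (hΛ q) hw0) hq0.le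
    rw [show ∀ y : ℝ, d n * y * (2 / L * M) = d n * (2 / L * (y * M)) from fun y => by ring]
    refine mul_le_mul_of_nonneg_left (mul_le_mul_of_nonneg_left ?_ (by positivity))
      (Nat.cast_nonneg _)
    by_cases hp : q.Prime
    · rw [ArithmeticFunction.vonMangoldt_apply_prime hp] at hx
      simp only [hp, true_and, if_true]
      split_ifs <;> linarith
    · simp only [hp, false_and, if_false]
      have h6 : M * (d q + 2) ≤ Λ q / q * (d q + 2) :=
        mul_le_mul_of_nonneg_right hx (by positivity)
      have h7 : Λ q / q * (d q + 2) = Λ q * (d q + 2) / q := by ring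
      linarith
  have hdiv : ∑ q ∈ s, (if q.Prime ∧ q ∣ n then Real.log q / q else 0) ≤
      ∑ p ∈ n.primeFactors, Real.log p / p := by
    rw [← Finset.sum_filter]
    refine Finset.sum_le_sum_of_subset_of_nonneg (fun q hq => ?_)
      fun p _ _ => div_nonneg (Real.log_natCast_nonneg p) (Nat.cast_nonneg _)
    have := (Finset.mem_filter.1 hq).2
    exact Nat.mem_primeFactors.2 ⟨this.1, this.2, hn0⟩
  rw [corrCoeff, Finset.mul_sum (f := fun q => liouvilleD (n * q) * smoothMangoldt T q / q)]
  refine le_trans ?_ (Finset.sum_le_sum hterm)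
  rw [← Finset.mul_sum, ← Finset.mul_sum, Finset.sum_sub_distrib, Finset.sum_sub_distrib,
    ← Finset.mul_sum]
  refine mul_le_mul_of_nonneg_left (mul_le_mul_of_nonneg_left ?_ (by positivity))
    (Nat.cast_nonneg _)
  have := hK s
  linarith

/-! ### Asymptotics of the diagonal terms -/

theorem log_cutoff {T : ℝ} (hT : 0 < T) (hL : 0 < Real.log T) :
    Real.log (cutoff T) = Real.log T - 2 * Real.log (Real.log T) := by
  rw [cutoff, Real.log_div hT.ne' (by positivity), Real.log_pow]; norm_num

theorem cutoff_le_self {T : ℝ} (hT : 0 < T) (hL : 1 ≤ Real.log T) : cutoff T ≤ T :=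
  div_le_self hT.le (one_le_pow₀ hL)

theorem tendsto_loglog_div_log :
    Tendsto (fun T => Real.log (Real.log T) / Real.log T) atTop (𝓝 0) :=
  (Real.isLittleO_log_id_atTop.tendsto_div_nhds_zero).comp Real.tendsto_log_atTop

theorem tendsto_const_div_log (C : ℝ) : Tendsto (fun T => C / Real.log T) atTop (𝓝 0) :=
  Real.tendsto_log_atTop.const_div_atTop C

theorem tendsto_sqrt_log_div_log :
    Tendsto (fun T => √(Real.log T) / Real.log T) atTop (𝓝 0) := by
  have : Tendsto (fun T => (√(Real.log T))⁻¹) atTop (𝓝 0) :=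
    (Real.tendsto_sqrt_atTop.comp Real.tendsto_log_atTop).inv_tendsto_atTop
  refine this.congr fun T => ?_
  rw [Real.sqrt_div_self]

theorem tendsto_cutoff : Tendsto cutoff atTop atTop := by
  have h : Tendsto (fun T : ℝ => Real.exp (Real.log T) / Real.log T ^ 2) atTop atTop :=
    (Real.tendsto_exp_div_pow_atTop 2).comp Real.tendsto_log_atTop
  refine h.congr' ?_
  filter_upwards [eventually_gt_atTop 0] with T hT
  rw [Real.exp_log hT, cutoff]

/-- Sums up to `T / log² T` have the same leading term as sums up to `T`. -/
theorem HasLogMean.tendsto_cutoff {F : ℕ → ℝ} {A : ℝ} {r : ℕ} (h : HasLogMean F A r) :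
    Tendsto (fun T => logSum F ⌈cutoff T⌉₊ / Real.log T ^ (r + 1)) atTop (𝓝 A) := by
  obtain ⟨C, hC0, hC⟩ := h.real
  have hratio : Tendsto (fun T => Real.log (cutoff T) / Real.log T) atTop (𝓝 1) := by
    have := (tendsto_const_nhds (x := (1:ℝ))).sub (tendsto_loglog_div_log.const_mul 2)
    rw [mul_zero, sub_zero] at this
    refine this.congr' ?_
    filter_upwards [eventually_gt_atTop 0, Real.tendsto_log_atTop.eventually_gt_atTop 0]
      with T hT hL
    rw [log_cutoff hT hL]; field_simp
  have h1 : Tendsto (fun T => A * (Real.log (cutoff T) / Real.log T) ^ (r + 1)) atTop (𝓝 A) := by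
    simpa using (hratio.pow (r + 1)).const_mul A
  have h2 : Tendsto (fun T => C * ((1 / Real.log T + Real.log (cutoff T) / Real.log T) ^ r *
      (1 / Real.log T))) atTop (𝓝 0) := by
    simpa using ((((tendsto_const_div_log 1).add hratio).pow r).mul
      (tendsto_const_div_log 1)).const_mul C
  have h3 : Tendsto (fun T => logSum F ⌈cutoff T⌉₊ / Real.log T ^ (r + 1) -
      A * (Real.log (cutoff T) / Real.log T) ^ (r + 1)) atTop (𝓝 0) := by
    refine squeeze_zero_norm' ?_ h2
    filter_upwards [Real.tendsto_log_atTop.eventually_gt_atTop 0,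
      LongDirichlet.tendsto_cutoff.eventually_ge_atTop 1] with T hL hx
    have := hC _ hx
    have e : logSum F ⌈cutoff T⌉₊ / Real.log T ^ (r + 1) -
        A * (Real.log (cutoff T) / Real.log T) ^ (r + 1) =
        (logSum F ⌈cutoff T⌉₊ - A * Real.log (cutoff T) ^ (r + 1)) / Real.log T ^ (r + 1) := by
      rw [div_pow]; ring
    rw [e, Real.norm_eq_abs, abs_div, abs_of_pos (pow_pos hL (r + 1)),
      div_le_iff₀ (pow_pos hL (r + 1))]
    refine this.trans (le_of_eq ?_)
    rw [← add_div, div_pow, pow_succ]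
    field_simp
  simpa using h3.add h1

/-- The quantity `log (x / n)`, where `x = T / log² T`, compared with `u = log T - log n`. -/
theorem log_cutoff_div {T : ℝ} (hT : 0 < T) (hL : 0 < Real.log T) {n : ℕ} (hn : 1 ≤ n) :
    Real.log (cutoff T / n) = Real.log T - Real.log n - 2 * Real.log (Real.log T) := by
  have hn0 : (n:ℝ) ≠ 0 := by exact_mod_cast (by omega : n ≠ 0)
  have hx : cutoff T ≠ 0 := (div_pos hT (by positivity)).ne'
  rw [Real.log_div hx hn0, log_cutoff hT hL]; ring

theorem one_le_cutoff_div {T : ℝ} {n : ℕ} (hn : n ∈ Ico 1 ⌈cutoff T⌉₊) : 1 ≤ cutoff T / n := by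
  obtain ⟨h1, h2⟩ := Finset.mem_Ico.1 hn
  rw [Nat.lt_ceil] at h2
  rw [le_div_iff₀ (by exact_mod_cast h1), one_mul]; exact h2.le

/-- Lower bound for the coefficients `corrCoeff`, with main term `2 d(n) (1 - v²)` for
`v = log n / log T`. -/
theorem exists_corrCoeff_ge : ∃ C : ℝ, 0 ≤ C ∧ ∀ T : ℝ, 0 < T → 1 ≤ Real.log T →
    ∀ n ∈ Ico 1 ⌈cutoff T⌉₊,
      d n * (2 * (1 - (Real.log n / Real.log T) ^ 2) -
        (8 * (Real.log (Real.log T) / Real.log T) + 4 * (√(Real.log T) / Real.log T) +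
          C / Real.log T)) ≤
      (ArithmeticFunction.liouville n : ℝ) * corrCoeff T n := by
  obtain ⟨K, hK0, hK⟩ := exists_sum_nonprime_le
  obtain ⟨C₁, hC₁, h1⟩ := hasLogMean_vonMangoldt.real
  obtain ⟨C₂, hC₂, h2⟩ := hasLogMean_vonMangoldt.mul_log.real
  refine ⟨4 * C₁ + 8 * C₂ + 2 * K, by positivity, fun T hT hL n hn => ?_⟩
  have hL0 : 0 < Real.log T := by linarith
  have hn1 := (Finset.mem_Ico.1 hn).1
  refine le_trans (mul_le_mul_of_nonneg_left ?_ (Nat.cast_nonneg _))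
    (liouville_mul_corrCoeff_ge hK hL0 hn1 (cutoff_le_self hT hL))
  have hz1 := one_le_cutoff_div hn
  have hlogz := log_cutoff_div hT hL0 hn1
  have hz0 := Real.log_nonneg hz1
  have a1 := h1 _ hz1
  have a2 := h2 _ hz1
  set z := cutoff T / n
  set L := Real.log T with hLdef
  set y := Real.log z with hy
  have hloglog : 0 ≤ Real.log L := Real.log_nonneg hL
  have hlogn : 0 ≤ Real.log n := Real.log_natCast_nonneg n
  simp only [zero_add, pow_one, pow_zero, mul_one, one_mul] at a1
  norm_num at a2
  have hS : ∑ q ∈ Ico 1 ⌈z⌉₊, Λ q * (1 - Real.log q / L) / q =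
      logSum Λ ⌈z⌉₊ - logSum (fun q => Λ q * Real.log q) ⌈z⌉₊ / L := by
    rw [logSum, logSum, Finset.sum_div, ← Finset.sum_sub_distrib]
    exact Finset.sum_congr rfl fun q _ => by ring
  rw [hS]
  set S₁ := logSum Λ ⌈z⌉₊
  set S₂ := logSum (fun q => Λ q * Real.log q) ⌈z⌉₊
  have b1 : y - C₁ ≤ S₁ := by linarith [(abs_le.1 a1).1]
  have b2 : S₂ ≤ 1 / 2 * y ^ 2 + C₂ * (1 + y) := by linarith [(abs_le.1 a2).2]
  have hyL : y ≤ L := by linarith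
  have b3 : S₂ ≤ 1 / 2 * y ^ 2 + C₂ * (2 * L) :=
    b2.trans (by have := mul_le_mul_of_nonneg_left (show 1 + y ≤ 2 * L by linarith) hC₂; linarith)
  have b4 : S₂ / L ≤ y ^ 2 / (2 * L) + 2 * C₂ := by
    rw [div_le_iff₀ hL0]
    refine b3.trans (le_of_eq ?_); field_simp
  have hP : ∑ p ∈ n.primeFactors, Real.log p / p ≤ 2 * √L := by
    refine (sum_log_div_primeFactors_le hn1).trans ?_
    have := Real.sqrt_le_sqrt (show Real.log n ≤ L by linarith)
    linarith
  set u := L - Real.log n with hu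
  -- `y - y² / (2 L)` is the main term of `S₁ - S₂ / L`, and `y = u - 2 log L`
  have b5 : u - u ^ 2 / (2 * L) - 2 * Real.log L ≤ y - y ^ 2 / (2 * L) := by
    have : y ^ 2 / (2 * L) ≤ u ^ 2 / (2 * L) :=
      div_le_div_of_nonneg_right (pow_le_pow_left₀ hz0 (by linarith) 2) (by positivity)
    linarith
  have b6 : u - u ^ 2 / (2 * L) = L * (1 - (Real.log n / L) ^ 2) / 2 := by
    rw [hu]; field_simp; ring
  have b7 : L * (1 - (Real.log n / L) ^ 2) - 4 * Real.log L - 2 * C₁ - 4 * C₂ - 2 * √L - K ≤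
      2 * (S₁ - S₂ / L) - ∑ p ∈ n.primeFactors, Real.log p / p - K := by linarith
  refine le_trans (le_of_eq ?_) (mul_le_mul_of_nonneg_left b7 (show 0 ≤ 2 / L by positivity))
  field_simp; ring

/-- Lower bound for the total of the terms subtracted in `sq_b_le`, with main term
`∑ d(m)² / m · v (1 - v)²` for `v = log m / log T`. -/
theorem exists_gain_ge : ∃ C : ℝ, 0 ≤ C ∧ ∀ T : ℝ, 0 < T → 1 ≤ Real.log T →
    ∑ m ∈ Ico 1 ⌈cutoff T⌉₊, (d m : ℝ) ^ 2 / m *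
      (Real.log m / Real.log T * (1 - Real.log m / Real.log T) ^ 2 -
        (4 * (Real.log (Real.log T) / Real.log T) + C / Real.log T)) ≤
    2 / Real.log T ^ 3 * ∑ n ∈ Ico 1 ⌈cutoff T⌉₊, (∑ z ∈ n.divisorsAntidiagonal,
      Λ z.2 * Real.log z.2 * ((d z.1 : ℝ) ^ 2 * Real.log z.1)) / n := by
  obtain ⟨C₂, hC₂, h2⟩ := hasLogMean_vonMangoldt.mul_log.real
  refine ⟨4 * C₂, by positivity, fun T hT hL => ?_⟩
  have hL0 : 0 < Real.log T := by linarith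
  have e : ∑ n ∈ Ico 1 ⌈cutoff T⌉₊, (∑ z ∈ n.divisorsAntidiagonal,
      Λ z.2 * Real.log z.2 * ((d z.1 : ℝ) ^ 2 * Real.log z.1)) / n =
      ∑ m ∈ Ico 1 ⌈cutoff T⌉₊, (d m : ℝ) ^ 2 / m * (Real.log m *
        logSum (fun q => Λ q * Real.log q) ⌈cutoff T / m⌉₊) := by
    have := sum_Ico_divisorsAntidiagonal (cutoff T)
      (fun z => Λ z.2 * Real.log z.2 * ((d z.1 : ℝ) ^ 2 * Real.log z.1) / (z.1 * z.2 : ℕ))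
    calc _ = _ := by
          refine Finset.sum_congr rfl fun n _ => ?_
          rw [Finset.sum_div]
          refine Finset.sum_congr rfl fun z hz => ?_
          rw [(Nat.mem_divisorsAntidiagonal.1 hz).1]
      _ = _ := this
      _ = _ := by
          refine Finset.sum_congr rfl fun m _ => ?_
          rw [logSum, Finset.mul_sum, Finset.mul_sum]
          refine Finset.sum_congr rfl fun q _ => ?_
          push_cast
          rw [div_mul_eq_mul_div, mul_div_assoc', mul_div_assoc', div_div]
          ring_nf
  rw [e, Finset.mul_sum]
  refine Finset.sum_le_sum fun m hm => ?_
  have hm1 := (Finset.mem_Ico.1 hm).1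
  have hz1 := one_le_cutoff_div hm
  have hlogz := log_cutoff_div hT hL0 hm1
  have hz0 := Real.log_nonneg hz1
  have a2 := h2 _ hz1
  norm_num at a2
  set z := cutoff T / m
  set L := Real.log T with hLdef
  set y := Real.log z with hy
  have hloglog : 0 ≤ Real.log L := Real.log_nonneg hL
  have hlogm : 0 ≤ Real.log m := Real.log_natCast_nonneg m
  set S₂ := logSum (fun q => Λ q * Real.log q) ⌈z⌉₊
  rw [mul_left_comm]
  refine mul_le_mul_of_nonneg_left ?_ (by positivity)
  have hyL : 1 + y ≤ 2 * L := by linarith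
  have b2 : 1 / 2 * y ^ 2 - C₂ * (2 * L) ≤ S₂ := by
    have := mul_le_mul_of_nonneg_left hyL hC₂
    linarith [(abs_le.1 a2).1]
  have b3 : (L - Real.log m) ^ 2 - 4 * L * Real.log L ≤ y ^ 2 := by
    rw [hlogz]
    have : 0 ≤ Real.log L * Real.log m := by positivity
    nlinarith [sq_nonneg (Real.log L)]
  have b4 : (L - Real.log m) ^ 2 / 2 - 2 * L * Real.log L - 2 * C₂ * L ≤ S₂ := by linarith
  have hv : Real.log m / L ≤ 1 := by rw [div_le_one hL0]; linarith
  have hd0 : 0 ≤ 4 * (Real.log L / L) + 4 * C₂ / L := by positivity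
  calc Real.log m / L * (1 - Real.log m / L) ^ 2 - (4 * (Real.log L / L) + 4 * C₂ / L)
      ≤ Real.log m / L * (1 - Real.log m / L) ^ 2 -
        Real.log m / L * (4 * (Real.log L / L) + 4 * C₂ / L) := by
        have := mul_le_mul_of_nonneg_right hv hd0
        linarith
    _ = 2 / L ^ 3 * (Real.log m *
          ((L - Real.log m) ^ 2 / 2 - 2 * L * Real.log L - 2 * C₂ * L)) := by
        field_simp; ring
    _ ≤ _ := mul_le_mul_of_nonneg_left (mul_le_mul_of_nonneg_left b4 hlogm) (by positivity)

/-- The coefficients `2 λ(n) d(n) (1 - v²)`, `v = log n / log T`, of the Dirichlet polynomial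
against which the product `A(t) · conj (Y(t))` is tested. They are the main terms of `corrCoeff`. -/
noncomputable def testCoeff (T : ℝ) (n : ℕ) : ℝ :=
  liouvilleD n * (2 * (1 - (Real.log n / Real.log T) ^ 2))

/-- The contribution of one `n` to Bessel's inequality, given the lower bound for `corrCoeff`. -/
theorem two_mul_testCoeff_mul_sub_sq_ge {T δ : ℝ} (hδ : 0 ≤ δ) (hL : 0 < Real.log T) {n : ℕ}
    (hn : 1 ≤ n) (hnT : Real.log n ≤ Real.log T)
    (h : d n * (2 * (1 - (Real.log n / Real.log T) ^ 2) - δ) ≤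
      (ArithmeticFunction.liouville n : ℝ) * corrCoeff T n) :
    (d n : ℝ) ^ 2 * (4 * (1 - (Real.log n / Real.log T) ^ 2) ^ 2 - 4 * δ) ≤
      2 * (testCoeff T n * corrCoeff T n) - testCoeff T n ^ 2 := by
  have hv0 : 0 ≤ Real.log n / Real.log T := div_nonneg (Real.log_natCast_nonneg n) hL.le
  have hv1 : Real.log n / Real.log T ≤ 1 := (div_le_one hL).2 hnT
  set v := Real.log n / Real.log T
  have hg0 : 0 ≤ 2 * (1 - v ^ 2) := by nlinarith
  have hg2 : 2 * (1 - v ^ 2) ≤ 2 := by nlinarith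
  set g := 2 * (1 - v ^ 2) with hg
  have hll := liouville_mul_self (show n ≠ 0 by omega)
  have e1 : testCoeff T n ^ 2 = (d n : ℝ) ^ 2 * g ^ 2 := by
    rw [testCoeff, liouvilleD]
    linear_combination (d n : ℝ) ^ 2 * g ^ 2 * hll
  have e2 : testCoeff T n * corrCoeff T n =
      (d n * g) * ((ArithmeticFunction.liouville n : ℝ) * corrCoeff T n) := by
    rw [testCoeff, liouvilleD]; ring
  have h1 := mul_le_mul_of_nonneg_left h (mul_nonneg (Nat.cast_nonneg (d n)) hg0)
  have h2 : (d n : ℝ) ^ 2 * (g * δ) ≤ (d n : ℝ) ^ 2 * (2 * δ) :=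
    mul_le_mul_of_nonneg_left (mul_le_mul_of_nonneg_right hg2 hδ) (sq_nonneg _)
  have e3 : 4 * (1 - v ^ 2) ^ 2 = g ^ 2 := by rw [hg]; ring
  rw [e1, e2, e3]
  linarith

/-- The diagonal contribution to the lower bound for the mean square of the tail. -/
noncomputable def diagonal (T : ℝ) : ℝ :=
  2 * logSum (fun n => testCoeff T n * corrCoeff T n) ⌈cutoff T⌉₊ -
    logSum (fun n => testCoeff T n ^ 2) ⌈cutoff T⌉₊ - logSum (fun n => b T n ^ 2) ⌈cutoff T⌉₊

/-- The lower bounds of the previous lemmas add up to `(4 / 105 + o(1)) A log⁴ T`. -/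
theorem eventually_diagonal_ge {A : ℝ} (hA : 0 < A)
    (h : HasLogMean (fun n => ((d n : ℕ) : ℝ) ^ 2) A 3) :
    ∀ᶠ T in atTop, 0.03 * A * Real.log T ^ 4 ≤ diagonal T := by
  obtain ⟨C, hC0, hC⟩ := exists_corrCoeff_ge
  obtain ⟨C', hC'0, hC'⟩ := exists_gain_ge
  set δ : ℝ → ℝ := fun T => 8 * (Real.log (Real.log T) / Real.log T) +
    4 * (√(Real.log T) / Real.log T) + C / Real.log T with hδ
  set δ' : ℝ → ℝ := fun T => 4 * (Real.log (Real.log T) / Real.log T) + C' / Real.log T with hδ'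
  have hδt : Tendsto δ atTop (𝓝 0) := by
    simpa using ((tendsto_loglog_div_log.const_mul 8).add
      (tendsto_sqrt_log_div_log.const_mul 4)).add (tendsto_const_div_log C)
  have hδt' : Tendsto δ' atTop (𝓝 0) := by
    simpa using (tendsto_loglog_div_log.const_mul 4).add (tendsto_const_div_log C')
  -- the moments `∑ d(n)² log^k n / n`, with limits `4 A / (4 + k)` after normalization
  have m0 := h.tendsto_cutoff
  have m1 := h.mul_log.tendsto_cutoff
  have m2 := h.mul_log.mul_log.tendsto_cutoff
  have m3 := h.mul_log.mul_log.mul_log.tendsto_cutoff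
  have m4 := h.mul_log.mul_log.mul_log.mul_log.tendsto_cutoff
  -- `4 (1 - v²)² - v² + v (1 - v)² = 4 + v - 11 v² + v³ + 4 v⁴`, whose integral against
  -- `4 v³ dv` over `[0, 1]` is `4 / 105 > 0.03`
  have hlim := ((((m0.const_mul 4).add m1).sub (m2.const_mul 11)).add m3).add (m4.const_mul 4)
  have hlim2 := hlim.sub (((hδt.const_mul 4).add hδt').mul m0)
  have hev := hlim2.eventually_const_le (u := 0.03 * A) (by push_cast; ring_nf; linarith)
  filter_upwards [hev, eventually_gt_atTop 0, Real.tendsto_log_atTop.eventually_ge_atTop 1]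
    with T hT1 hT0 hL
  have hL0 : 0 < Real.log T := by linarith
  have hxT := cutoff_le_self hT0 hL
  have hloglog : 0 ≤ Real.log (Real.log T) := Real.log_nonneg hL
  have hδ0 : 0 ≤ δ T := by rw [hδ]; positivity
  have hmain : ∑ n ∈ Ico 1 ⌈cutoff T⌉₊, (d n : ℝ) ^ 2 / n *
      (4 + Real.log n / Real.log T - 11 * (Real.log n / Real.log T) ^ 2 +
        (Real.log n / Real.log T) ^ 3 + 4 * (Real.log n / Real.log T) ^ 4 -
        (4 * δ T + δ' T)) ≤ diagonal T := by
    have p1 : ∑ n ∈ Ico 1 ⌈cutoff T⌉₊, (d n : ℝ) ^ 2 *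
        (4 * (1 - (Real.log n / Real.log T) ^ 2) ^ 2 - 4 * δ T) / n ≤
        2 * logSum (fun n => testCoeff T n * corrCoeff T n) ⌈cutoff T⌉₊ -
          logSum (fun n => testCoeff T n ^ 2) ⌈cutoff T⌉₊ := by
      rw [logSum, logSum, Finset.mul_sum, ← Finset.sum_sub_distrib]
      refine Finset.sum_le_sum fun n hn => ?_
      rw [mul_div_assoc', ← sub_div]
      have hn' := Finset.mem_Ico.1 hn
      refine div_le_div_of_nonneg_right (two_mul_testCoeff_mul_sub_sq_ge hδ0 hL0 hn'.1
        (Real.log_le_log (by exact_mod_cast hn'.1) ((Nat.lt_ceil.1 hn'.2).le.trans hxT))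
        (hC T hT0 hL n hn)) (Nat.cast_nonneg _)
    have p2 : logSum (fun n => b T n ^ 2) ⌈cutoff T⌉₊ ≤
        ∑ n ∈ Ico 1 ⌈cutoff T⌉₊, (d n * Real.log n / Real.log T) ^ 2 / n -
        2 / Real.log T ^ 3 * ∑ n ∈ Ico 1 ⌈cutoff T⌉₊, (∑ z ∈ n.divisorsAntidiagonal,
          Λ z.2 * Real.log z.2 * ((d z.1 : ℝ) ^ 2 * Real.log z.1)) / n := by
      rw [logSum, Finset.mul_sum, ← Finset.sum_sub_distrib]
      refine Finset.sum_le_sum fun n hn => ?_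
      rw [mul_div_assoc', ← sub_div]
      have hn' := Finset.mem_Ico.1 hn
      exact div_le_div_of_nonneg_right (sq_b_le hL0 ((Nat.lt_ceil.1 hn'.2).le.trans hxT))
        (Nat.cast_nonneg _)
    have p3 := hC' T hT0 hL
    have e : ∑ n ∈ Ico 1 ⌈cutoff T⌉₊, (d n : ℝ) ^ 2 / n *
        (4 + Real.log n / Real.log T - 11 * (Real.log n / Real.log T) ^ 2 +
          (Real.log n / Real.log T) ^ 3 + 4 * (Real.log n / Real.log T) ^ 4 -
          (4 * δ T + δ' T)) =
        ∑ n ∈ Ico 1 ⌈cutoff T⌉₊, (d n : ℝ) ^ 2 *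
          (4 * (1 - (Real.log n / Real.log T) ^ 2) ^ 2 - 4 * δ T) / n -
        ∑ n ∈ Ico 1 ⌈cutoff T⌉₊, (d n * Real.log n / Real.log T) ^ 2 / n +
        ∑ m ∈ Ico 1 ⌈cutoff T⌉₊, (d m : ℝ) ^ 2 / m *
          (Real.log m / Real.log T * (1 - Real.log m / Real.log T) ^ 2 - δ' T) := by
      rw [← Finset.sum_sub_distrib, ← Finset.sum_add_distrib]
      exact Finset.sum_congr rfl fun n _ => by ring
    rw [e, diagonal]
    linarith
  refine le_trans ?_ hmain
  have hL4 : 0 < Real.log T ^ 4 := by positivity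
  calc 0.03 * A * Real.log T ^ 4 ≤ _ := mul_le_mul_of_nonneg_right hT1 hL4.le
    _ = _ := by
      simp only [logSum, Finset.sum_div, Finset.mul_sum, ← Finset.sum_sub_distrib,
        ← Finset.sum_add_distrib, Finset.sum_mul]
      refine Finset.sum_congr rfl fun n hn => ?_
      have hn0 : (n:ℝ) ≠ 0 := by
        have := (Finset.mem_Ico.1 hn).1
        exact_mod_cast (by omega : n ≠ 0)
      field_simp
      ring

/-! ### The Gaussian weight and quasi-orthogonality -/

theorem integrable_omega {T : ℝ} (hT : 0 < T) (hL : 0 < Real.log T) : Integrable (omega T) := by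
  have h := (integrable_exp_neg_mul_sq (b := Real.log T ^ 2 / T ^ 2) (by positivity)).comp_sub_right T
  refine (h.const_mul (Real.log T / (√Real.pi * T))).congr (Eventually.of_forall fun t => ?_)
  simp only [omega]
  congr 2; ring

theorem omega_nonneg {T : ℝ} (hT : 0 < T) (hL : 0 < Real.log T) (t : ℝ) : 0 ≤ omega T t := by
  unfold omega; positivity

/-- The Fourier transform of the weight. -/
theorem integral_omega_mul_cexp {T : ℝ} (hT : 0 < T) (hL : 0 < Real.log T) (θ : ℝ) :
    ∫ t : ℝ, (omega T t : ℂ) * Complex.exp (-(t * θ : ℝ) * Complex.I) =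
      Complex.exp (-(T * θ : ℝ) * Complex.I) *
        (Real.exp (-(θ ^ 2 * T ^ 2 / (4 * Real.log T ^ 2))) : ℝ) := by
  set L := Real.log T with hLdef
  set β : ℝ := L ^ 2 / T ^ 2 with hβ
  have hβ0 : 0 < β := by positivity
  have h1 : ∀ t : ℝ, (omega T t : ℂ) * Complex.exp (-(t * θ : ℝ) * Complex.I) =
      (fun s : ℝ => ((L / (√Real.pi * T) : ℝ) : ℂ) * Complex.exp (-(T * θ : ℝ) * Complex.I) *
        (Complex.exp (Complex.I * (-θ : ℝ) * s) * Complex.exp (-(β : ℂ) * (s:ℂ) ^ 2))) (t - T) := by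
    intro t
    simp only [omega]
    rw [Complex.ofReal_mul, Complex.ofReal_exp, mul_assoc, mul_assoc, ← Complex.exp_add,
      ← Complex.exp_add, ← Complex.exp_add]
    congr 2
    rw [hβ]; push_cast; ring
  rw [integral_congr_ae (Eventually.of_forall h1), integral_sub_right_eq_self
    (fun s : ℝ => ((L / (√Real.pi * T) : ℝ) : ℂ) * Complex.exp (-(T * θ : ℝ) * Complex.I) *
        (Complex.exp (Complex.I * (-θ : ℝ) * s) * Complex.exp (-(β : ℂ) * (s:ℂ) ^ 2))) T,
    integral_const_mul, fourierIntegral_gaussian (by simpa using hβ0)]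
  have h2 : ((Real.pi : ℂ) / β) ^ (1 / 2 : ℂ) = ((√Real.pi * T / L : ℝ) : ℂ) := by
    have : √(Real.pi / β) = √Real.pi * T / L := by
      rw [hβ, Real.sqrt_div Real.pi_pos.le, Real.sqrt_div (by positivity), Real.sqrt_sq hL.le,
        Real.sqrt_sq hT.le]
      field_simp
    rw [← this, Real.sqrt_eq_rpow, Complex.ofReal_cpow (by positivity)]
    push_cast; rfl
  have h3 : -((-θ : ℝ) : ℂ) ^ 2 / (4 * (β : ℂ)) = ((-(θ ^ 2 * T ^ 2 / (4 * L ^ 2)) : ℝ) : ℂ) := by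
    have : (-(θ ^ 2 * T ^ 2 / (4 * L ^ 2)) : ℝ) = -(-θ) ^ 2 / (4 * β) := by
      rw [hβ]; field_simp
    rw [this]; push_cast; ring
  rw [h2, h3, ← Complex.ofReal_exp]
  have h4 : ((L / (√Real.pi * T) : ℝ) : ℂ) * ((√Real.pi * T / L : ℝ) : ℂ) = 1 := by
    rw [← Complex.ofReal_mul]
    have : L / (√Real.pi * T) * (√Real.pi * T / L) = 1 := by
      have := Real.sqrt_pos.2 Real.pi_pos
      field_simp
    rw [this, Complex.ofReal_one]
  linear_combination (Complex.exp (-(T * θ : ℝ) * Complex.I) *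
        (Real.exp (-(θ ^ 2 * T ^ 2 / (4 * L ^ 2))) : ℝ)) * h4

/-- The exponential sum `∑ α_i e^(-i t θ_i)` with real coefficients. -/
noncomputable def expSum {ι : Type*} (s : Finset ι) (α θ : ι → ℝ) (t : ℝ) : ℂ :=
  ∑ i ∈ s, (α i : ℂ) * Complex.exp (-(t * θ i : ℝ) * Complex.I)

theorem continuous_expSum {ι : Type*} (s : Finset ι) (α θ : ι → ℝ) :
    Continuous (expSum s α θ) := by
  unfold expSum; fun_prop

theorem norm_expSum_le {ι : Type*} (s : Finset ι) (α θ : ι → ℝ) (t : ℝ) :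
    ‖expSum s α θ t‖ ≤ ∑ i ∈ s, |α i| := by
  refine (norm_sum_le _ _).trans (Finset.sum_le_sum fun i _ => ?_)
  rw [norm_mul, ← Complex.ofReal_neg, Complex.norm_exp_ofReal_mul_I, mul_one, Complex.norm_real,
    Real.norm_eq_abs]

theorem conj_expSum {ι : Type*} (s : Finset ι) (α θ : ι → ℝ) (t : ℝ) :
    conj (expSum s α θ t) = expSum s α (fun i => -θ i) t := by
  unfold expSum
  rw [map_sum]
  refine Finset.sum_congr rfl fun i _ => ?_
  rw [map_mul, Complex.conj_ofReal, ← Complex.exp_conj, map_mul, Complex.conj_I, map_neg,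
    Complex.conj_ofReal]
  congr 2; push_cast; ring

theorem expSum_mul {ι κ : Type*} (s : Finset ι) (s' : Finset κ) (α θ : ι → ℝ) (β φ : κ → ℝ)
    (t : ℝ) : expSum s α θ t * expSum s' β φ t =
      expSum (s ×ˢ s') (fun z => α z.1 * β z.2) (fun z => θ z.1 + φ z.2) t := by
  unfold expSum
  rw [Finset.sum_mul_sum, Finset.sum_product]
  refine Finset.sum_congr rfl fun i _ => Finset.sum_congr rfl fun j _ => ?_
  rw [mul_mul_mul_comm, ← Complex.exp_add]
  push_cast
  congr 2; ring

theorem integrable_omega_mul_re {ι κ : Type*} {T : ℝ} (hT : 0 < T) (hL : 0 < Real.log T)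
    (s : Finset ι) (s' : Finset κ) (α θ : ι → ℝ) (β φ : κ → ℝ) :
    Integrable fun t => omega T t * (expSum s α θ t * conj (expSum s' β φ t)).re := by
  refine (integrable_omega hT hL).mul_bdd (c := (∑ i ∈ s, |α i|) * ∑ j ∈ s', |β j|) ?_ ?_
  · have := continuous_expSum s α θ
    have := continuous_expSum s' β φ
    exact Continuous.aestronglyMeasurable (by fun_prop)
  · refine Eventually.of_forall fun t => ?_
    rw [Real.norm_eq_abs]
    refine (Complex.abs_re_le_norm _).trans ?_
    rw [norm_mul, RCLike.norm_conj]
    exact mul_le_mul (norm_expSum_le s α θ t) (norm_expSum_le s' β φ t) (norm_nonneg _)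
      (Finset.sum_nonneg fun _ _ => abs_nonneg _)

theorem integral_omega_mul_expSum {ι : Type*} {T : ℝ} (hT : 0 < T) (hL : 0 < Real.log T)
    (s : Finset ι) (α θ : ι → ℝ) :
    ∫ t : ℝ, (omega T t : ℂ) * expSum s α θ t = ∑ i ∈ s, (α i : ℂ) *
      (Complex.exp (-(T * θ i : ℝ) * Complex.I) *
        (Real.exp (-(θ i ^ 2 * T ^ 2 / (4 * Real.log T ^ 2))) : ℝ)) := by
  have h1 : ∀ t : ℝ, (omega T t : ℂ) * expSum s α θ t = ∑ i ∈ s, (α i : ℂ) *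
      ((omega T t : ℂ) * Complex.exp (-(t * θ i : ℝ) * Complex.I)) := by
    intro t
    rw [expSum, Finset.mul_sum]
    exact Finset.sum_congr rfl fun i _ => by ring
  rw [integral_congr_ae (Eventually.of_forall h1), integral_finsetSum]
  · refine Finset.sum_congr rfl fun i _ => ?_
    rw [integral_const_mul, integral_omega_mul_cexp hT hL]
  · intro i _
    refine Integrable.const_mul ?_ _
    refine (integrable_omega hT hL).ofReal.mul_bdd (c := 1) ?_ (Eventually.of_forall fun t => ?_)
    · exact Continuous.aestronglyMeasurable (by fun_prop)
    · rw [← Complex.ofReal_neg, Complex.norm_exp_ofReal_mul_I]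

/-- Quasi-orthogonality: if the frequencies of two exponential sums either coincide (relation `R`)
or differ by at least `ρ`, then only the coinciding pairs contribute to their weighted inner
product, up to a Gaussian error. -/
theorem abs_integral_sub_diagonal_le {ι κ : Type*} {T ρ : ℝ} (hT : 0 < T) (hL : 0 < Real.log T)
    (hρ : 0 ≤ ρ) (s : Finset ι) (s' : Finset κ) (α θ : ι → ℝ) (β φ : κ → ℝ) (R : ι → κ → Prop)
    [∀ i j, Decidable (R i j)] (hR : ∀ i ∈ s, ∀ j ∈ s', R i j → θ i = φ j)
    (hsep : ∀ i ∈ s, ∀ j ∈ s', ¬ R i j → ρ ≤ |θ i - φ j|) :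
    |(∫ t : ℝ, omega T t * (expSum s α θ t * conj (expSum s' β φ t)).re) -
      ∑ i ∈ s, ∑ j ∈ s', if R i j then α i * β j else 0| ≤
    (∑ i ∈ s, |α i|) * (∑ j ∈ s', |β j|) *
      Real.exp (-(ρ ^ 2 * T ^ 2 / (4 * Real.log T ^ 2))) := by
  set E : ℝ → ℝ := fun θ => Real.exp (-(θ ^ 2 * T ^ 2 / (4 * Real.log T ^ 2))) with hE
  have h1 : ∫ t : ℝ, omega T t * (expSum s α θ t * conj (expSum s' β φ t)).re =
      (∫ t : ℝ, (omega T t : ℂ) * expSum (s ×ˢ s') (fun z => α z.1 * β z.2)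
        (fun z => θ z.1 + -φ z.2) t).re := by
    have hint : Integrable fun t : ℝ => (omega T t : ℂ) * expSum (s ×ˢ s')
        (fun z => α z.1 * β z.2) (fun z => θ z.1 + -φ z.2) t := by
      refine (integrable_omega hT hL).ofReal.mul_bdd (c := ∑ z ∈ s ×ˢ s', |α z.1 * β z.2|)
        (continuous_expSum _ _ _).aestronglyMeasurable
        (Eventually.of_forall fun t => norm_expSum_le _ _ _ t)
    rw [← RCLike.re_eq_complex_re, ← integral_re hint]
    refine integral_congr_ae (Eventually.of_forall fun t => ?_)
    simp only [RCLike.re_eq_complex_re]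
    rw [Complex.re_ofReal_mul, conj_expSum, expSum_mul]
  rw [h1, integral_omega_mul_expSum hT hL, Finset.sum_product, Complex.re_sum,
    ← Finset.sum_sub_distrib, Finset.sum_mul_sum, Finset.sum_mul]
  refine (Finset.abs_sum_le_sum_abs _ _).trans (Finset.sum_le_sum fun i hi => ?_)
  rw [Complex.re_sum, ← Finset.sum_sub_distrib, Finset.sum_mul]
  refine (Finset.abs_sum_le_sum_abs _ _).trans (Finset.sum_le_sum fun j hj => ?_)
  by_cases h : R i j
  · have h0 : θ i + -φ j = 0 := by rw [hR i hi j hj h]; ring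
    rw [if_pos h, h0]
    simp only [mul_zero, Complex.ofReal_zero, neg_zero, zero_mul, Complex.exp_zero, one_mul]
    norm_num
    positivity
  · rw [if_neg h, sub_zero]
    refine (Complex.abs_re_le_norm _).trans ?_
    rw [norm_mul, norm_mul, ← Complex.ofReal_neg (T * _), Complex.norm_exp_ofReal_mul_I, one_mul,
      Complex.norm_real, Complex.norm_real, Real.norm_eq_abs, Real.norm_eq_abs, abs_mul,
      Real.abs_exp]
    refine mul_le_mul_of_nonneg_left (Real.exp_le_exp.2 ?_) (by positivity)
    rw [neg_le_neg_iff]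
    refine div_le_div_of_nonneg_right (mul_le_mul_of_nonneg_right ?_ (by positivity))
      (by positivity)
    rw [← sub_eq_add_neg, ← sq_abs (θ i - φ j)]
    exact pow_le_pow_left₀ hρ (hsep i hi j hj h) 2

/-- Logarithms of distinct positive integers, one of them below `x`, are well spaced. -/
theorem le_abs_log_sub_log {x : ℝ} {a b : ℕ} (ha : 1 ≤ a) (hb : 1 ≤ b) (hab : a ≠ b)
    (hax : (a:ℝ) < x) : 1 / (2 * x) ≤ |Real.log a - Real.log b| := by
  have key : ∀ m n : ℕ, 1 ≤ m → m < n → 1 / (n:ℝ) ≤ Real.log n - Real.log m := by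
    intro m n hm hmn
    have hm0 : (0:ℝ) < m := by exact_mod_cast hm
    have hn0 : (0:ℝ) < n := by exact_mod_cast (by omega : 0 < n)
    have h1 := Real.log_le_sub_one_of_pos (div_pos hm0 hn0)
    rw [Real.log_div hm0.ne' hn0.ne'] at h1
    have h2 : (m:ℝ) + 1 ≤ n := by exact_mod_cast hmn
    have h3 : 1 / (n:ℝ) ≤ 1 - m / n := by
      rw [le_sub_iff_add_le, ← add_div, div_le_one hn0]; linarith
    linarith
  have ha0 : (1:ℝ) ≤ a := by exact_mod_cast ha
  rcases lt_or_gt_of_ne hab with h | h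
  · have h1 := key a (a + 1) ha (by omega)
    have h2 : Real.log (a + 1 : ℕ) ≤ Real.log b :=
      Real.log_le_log (by positivity) (by exact_mod_cast h)
    have h3 : 1 / (2 * x) ≤ 1 / ((a + 1 : ℕ):ℝ) := by
      apply one_div_le_one_div_of_le (by positivity); push_cast; linarith
    rw [abs_sub_comm]
    exact le_trans (by linarith) (le_abs_self _)
  · have h1 := key b a hb h
    have h3 : 1 / (2 * x) ≤ 1 / (a:ℝ) := by
      apply one_div_le_one_div_of_le (by positivity); linarith
    exact le_trans (by linarith) (le_abs_self _)

/-! ### The tail as a Dirichlet polynomial -/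

/-- The Dirichlet polynomial `∑_{n ∈ s} α(n) n^(-1/2-it)`. -/
noncomputable def dirPoly (s : Finset ℕ) (α : ℕ → ℝ) : ℝ → ℂ :=
  expSum s (fun n => α n / √n) (fun n => Real.log n)

theorem div_cpow_eq (r t : ℝ) {n : ℕ} (hn : 1 ≤ n) :
    (r : ℂ) / (n : ℂ) ^ ((1 / 2 : ℂ) + t * Complex.I) =
      ((r / √n : ℝ) : ℂ) * Complex.exp (-(t * Real.log n : ℝ) * Complex.I) := by
  have hn0 : (n : ℂ) ≠ 0 := by exact_mod_cast (by omega : n ≠ 0)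
  have h1 : (n : ℂ) ^ (1 / 2 : ℂ) = ((√n : ℝ) : ℂ) := by
    rw [Real.sqrt_eq_rpow, Complex.ofReal_cpow n.cast_nonneg]; push_cast; rfl
  have h2 : (n : ℂ) ^ ((t:ℂ) * Complex.I) = Complex.exp ((t * Real.log n : ℝ) * Complex.I) := by
    rw [Complex.cpow_def_of_ne_zero hn0, ← Complex.natCast_log]; push_cast; congr 1; ring
  rw [Complex.cpow_add _ _ hn0, h1, h2, neg_mul, Complex.exp_neg, Complex.ofReal_div]
  field_simp

theorem tail_eq_dirPoly {T : ℝ} (hT : 0 ≤ T) (hx : 1 ≤ cutoff T) (t : ℝ) :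
    tail T t = dirPoly (Ico ⌈cutoff T⌉₊ ⌈cutoff T * T⌉₊) (b T) t := by
  have h1 := tsum_subtype {n : ℕ | cutoff T ≤ (n : ℝ)}
    (fun n : ℕ => (b T n : ℂ) / (n : ℂ) ^ ((1 / 2 : ℂ) + t * Complex.I))
  refine (show tail T t = _ from h1).trans ?_
  rw [tsum_eq_sum (s := Ico ⌈cutoff T⌉₊ ⌈cutoff T * T⌉₊), dirPoly, expSum]
  · refine Finset.sum_congr rfl fun n hn => ?_
    have h2 : cutoff T ≤ n := Nat.ceil_le.1 (Finset.mem_Ico.1 hn).1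
    rw [Set.indicator_of_mem (show n ∈ {n : ℕ | cutoff T ≤ (n : ℝ)} from h2),
      div_cpow_eq _ _ (by exact_mod_cast hx.trans h2)]
  · intro n hn
    by_cases h2 : cutoff T ≤ n
    · have h3 : cutoff T * T ≤ n := by
        rw [Finset.mem_Ico, not_and, not_lt] at hn
        exact Nat.ceil_le.1 (hn (Nat.ceil_le.2 h2))
      rw [Set.indicator_of_mem (show n ∈ {n : ℕ | cutoff T ≤ (n : ℝ)} from h2),
        b_eq_zero_of_le hT h3]
      simp
    · exact Set.indicator_of_notMem (show n ∉ {n : ℕ | cutoff T ≤ (n : ℝ)} from h2) _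

/-- Summation of a function of `n = m q` over `m < x`, `q < T`. -/
theorem sum_product_eq_sum_filter {M : Type*} [AddCommMonoid M] {x T : ℝ}
    (f : ℕ × ℕ → M) :
    ∑ n ∈ Ico 1 ⌈x * T⌉₊, ∑ z ∈ n.divisorsAntidiagonal with (z.1 : ℝ) < x ∧ (z.2 : ℝ) < T, f z =
      ∑ z ∈ Ico 1 ⌈x⌉₊ ×ˢ Ico 1 ⌈T⌉₊, f z := by
  rw [← Finset.sum_fiberwise_of_maps_to (g := fun z : ℕ × ℕ => z.1 * z.2) (t := Ico 1 ⌈x * T⌉₊)]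
  · refine Finset.sum_congr rfl fun n hn => Finset.sum_congr ?_ fun _ _ => rfl
    ext z
    simp only [Finset.mem_filter, Nat.mem_divisorsAntidiagonal, Finset.mem_product, Finset.mem_Ico,
      Nat.lt_ceil]
    constructor
    · rintro ⟨⟨h1, h2⟩, h3, h4⟩
      refine ⟨⟨⟨?_, h3⟩, ?_, h4⟩, h1⟩
      · exact Nat.pos_of_ne_zero fun h => h2 (by rw [← h1, h, zero_mul])
      · exact Nat.pos_of_ne_zero fun h => h2 (by rw [← h1, h, mul_zero])
    · rintro ⟨⟨⟨h1, h2⟩, h3, h4⟩, h5⟩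
      exact ⟨⟨h5, by rw [← h5]; exact (Nat.mul_pos h1 h3).ne'⟩, h2, h4⟩
  · intro z hz
    simp only [Finset.mem_product, Finset.mem_Ico, Nat.lt_ceil] at hz ⊢
    refine ⟨Nat.mul_pos hz.1.1 hz.2.1, ?_⟩
    push_cast
    exact mul_lt_mul'' hz.1.2 hz.2.2 (Nat.cast_nonneg _) (Nat.cast_nonneg _)

/-- The polynomial with coefficients `b` factors as `A(t) Y(t)`. -/
theorem dirPoly_b_eq_mul (T t : ℝ) :
    dirPoly (Ico 1 ⌈cutoff T * T⌉₊) (b T) t =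
      dirPoly (Ico 1 ⌈cutoff T⌉₊) liouvilleD t * dirPoly (Ico 1 ⌈T⌉₊) (smoothMangoldt T) t := by
  rw [dirPoly, dirPoly, dirPoly, expSum_mul, expSum, expSum,
    ← sum_product_eq_sum_filter (x := cutoff T) (T := T)]
  refine Finset.sum_congr rfl fun n _ => ?_
  rw [b_eq_sum, Finset.sum_div, Complex.ofReal_sum, Finset.sum_mul]
  refine Finset.sum_congr rfl fun z hz => ?_
  obtain ⟨h1, h2⟩ := Nat.mem_divisorsAntidiagonal.1 (Finset.mem_of_mem_filter z hz)
  have hm : (z.1 : ℝ) ≠ 0 := by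
    exact_mod_cast fun h : z.1 = 0 => h2 (by rw [← h1, h, zero_mul])
  have hq : (z.2 : ℝ) ≠ 0 := by
    exact_mod_cast fun h : z.2 = 0 => h2 (by rw [← h1, h, mul_zero])
  rw [← h1, Nat.cast_mul, Real.log_mul hm hq, Real.sqrt_mul (Nat.cast_nonneg _), mul_div_mul_comm]

/-- The pointwise form of the argument: `|p|² = |h + p|² - |h|² - 2 Re (p conj h)`, the modulus of
`h + p = a y` does not change when `y` is conjugated, and `|u|² ≥ 2 Re (u conj w) - |w|²`. -/
theorem norm_sq_ge_of_add_eq_mul {p h a y w : ℂ} (hpay : h + p = a * y) :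
    2 * (a * conj y * conj w).re - (w * conj w).re - (h * conj h).re - 2 * (p * conj h).re ≤
      ‖p‖ ^ 2 := by
  have h1 : ‖h + p‖ ^ 2 = ‖a * conj y‖ ^ 2 := by
    rw [hpay, norm_mul, norm_mul, RCLike.norm_conj]
  have h2 : 0 ≤ ‖a * conj y - w‖ ^ 2 := sq_nonneg _
  generalize a * conj y = u at h1 h2 ⊢
  simp only [← Complex.normSq_eq_norm_sq, Complex.normSq_apply, Complex.add_re, Complex.add_im,
    Complex.sub_re, Complex.sub_im, Complex.mul_re, Complex.conj_re, Complex.conj_im] at *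
  linarith

theorem card_Ico_one_ceil_le {x : ℝ} (hx : 0 ≤ x) : ((Ico 1 ⌈x⌉₊).card : ℝ) ≤ x := by
  rw [Nat.card_Ico]
  rcases Nat.eq_zero_or_pos ⌈x⌉₊ with h | h
  · rw [h]; simpa using hx
  · rw [Nat.cast_sub h]
    push_cast
    linarith [Nat.ceil_lt_add_one hx]

theorem abs_div_sqrt_le (r : ℝ) {n : ℕ} (hn : 1 ≤ n) : |r / √n| ≤ |r| := by
  rw [abs_div, abs_of_nonneg (Real.sqrt_nonneg _)]
  exact div_le_self (abs_nonneg _) (Real.one_le_sqrt.2 (by exact_mod_cast hn))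

theorem abs_smoothMangoldt_le {T : ℝ} (hL : 0 < Real.log T) {q : ℕ}
    (hq : q ∈ Ico 1 ⌈T⌉₊) : |smoothMangoldt T q| ≤ 2 := by
  obtain ⟨h1, h2⟩ := Finset.mem_Ico.1 hq
  rw [Nat.lt_ceil] at h2
  have hlog : Real.log q ≤ Real.log T := Real.log_le_log (by exact_mod_cast h1) h2.le
  have hlog0 := Real.log_natCast_nonneg q
  have hw0 : 0 ≤ 1 - Real.log q / Real.log T := by rw [sub_nonneg, div_le_one hL]; exact hlog
  have hw1 : 1 - Real.log q / Real.log T ≤ 1 := by rw [sub_le_self_iff]; positivity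
  have hΛ0 : 0 ≤ Λ q := ArithmeticFunction.vonMangoldt_nonneg
  rw [smoothMangoldt, abs_mul, abs_neg, abs_of_nonneg (by positivity : 0 ≤ 2 / Real.log T),
    abs_of_nonneg (mul_nonneg hΛ0 hw0)]
  have h3 : Λ q * (1 - Real.log q / Real.log T) ≤ Real.log T :=
    (mul_le_of_le_one_right hΛ0 hw1).trans (ArithmeticFunction.vonMangoldt_le_log.trans hlog)
  calc _ ≤ 2 / Real.log T * Real.log T := mul_le_mul_of_nonneg_left h3 (by positivity)
    _ = 2 := by field_simp

theorem d_le_of_mem {T : ℝ} (hxT : cutoff T ≤ T) {m : ℕ} (hm : m ∈ Ico 1 ⌈cutoff T⌉₊) :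
    (d m : ℝ) ≤ T := by
  have h := Nat.lt_ceil.1 (Finset.mem_Ico.1 hm).2
  exact le_trans (by exact_mod_cast d_le_self m) (h.le.trans hxT)

theorem sum_abs_product_le {T : ℝ} (hT : 0 < T) (hL : 0 < Real.log T) (hxT : cutoff T ≤ T)
    (hx : 0 ≤ cutoff T) :
    ∑ z ∈ Ico 1 ⌈cutoff T⌉₊ ×ˢ Ico 1 ⌈T⌉₊, |liouvilleD z.1 * smoothMangoldt T z.2| ≤
      2 * T ^ 3 := by
  calc _ ≤ ∑ z ∈ Ico 1 ⌈cutoff T⌉₊ ×ˢ Ico 1 ⌈T⌉₊, T * 2 := by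
        refine Finset.sum_le_sum fun z hz => ?_
        rw [Finset.mem_product] at hz
        rw [abs_mul, abs_liouvilleD]
        exact mul_le_mul (d_le_of_mem hxT hz.1) (abs_smoothMangoldt_le hL hz.2) (abs_nonneg _) hT.le
    _ = ((Ico 1 ⌈cutoff T⌉₊).card : ℝ) * ((Ico 1 ⌈T⌉₊).card : ℝ) * (T * 2) := by
        rw [Finset.sum_const, Finset.card_product, nsmul_eq_mul]; push_cast; ring
    _ ≤ T * T * (T * 2) := by
        refine mul_le_mul_of_nonneg_right ?_ (by positivity)
        exact mul_le_mul ((card_Ico_one_ceil_le hx).trans hxT) (card_Ico_one_ceil_le hT.le)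
          (Nat.cast_nonneg _) hT.le
    _ = _ := by ring

theorem sum_abs_b_le {T : ℝ} (hT : 0 < T) (hL : 0 < Real.log T) (hxT : cutoff T ≤ T)
    (hx : 0 ≤ cutoff T) : ∑ n ∈ Ico 1 ⌈cutoff T * T⌉₊, |b T n| ≤ 2 * T ^ 3 := by
  refine le_trans ?_ (sum_abs_product_le hT hL hxT hx)
  rw [← sum_product_eq_sum_filter (x := cutoff T) (T := T)]
  refine Finset.sum_le_sum fun n _ => ?_
  rw [b_eq_sum]
  exact Finset.abs_sum_le_sum_abs _ _

theorem sum_abs_testCoeff_le {T : ℝ} (hT : 1 ≤ T) (hL : 0 < Real.log T) (hxT : cutoff T ≤ T)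
    (hx : 0 ≤ cutoff T) : ∑ n ∈ Ico 1 ⌈cutoff T⌉₊, |testCoeff T n| ≤ 2 * T ^ 3 := by
  calc _ ≤ ∑ n ∈ Ico 1 ⌈cutoff T⌉₊, T * 2 := by
        refine Finset.sum_le_sum fun n hn => ?_
        rw [testCoeff, abs_mul, abs_liouvilleD]
        refine mul_le_mul (d_le_of_mem hxT hn) ?_ (abs_nonneg _) (by linarith)
        obtain ⟨h1, h2⟩ := Finset.mem_Ico.1 hn
        have h3 : Real.log n ≤ Real.log T :=
          Real.log_le_log (by exact_mod_cast h1) ((Nat.lt_ceil.1 h2).le.trans hxT)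
        have hv0 : 0 ≤ Real.log n / Real.log T := div_nonneg (Real.log_natCast_nonneg n) hL.le
        have hv1 : Real.log n / Real.log T ≤ 1 := (div_le_one hL).2 h3
        rw [abs_le]; constructor <;> nlinarith
    _ = ((Ico 1 ⌈cutoff T⌉₊).card : ℝ) * (T * 2) := by rw [Finset.sum_const, nsmul_eq_mul]
    _ ≤ T * (T * 2) := mul_le_mul_of_nonneg_right ((card_Ico_one_ceil_le hx).trans hxT)
        (by linarith)
    _ ≤ _ := by nlinarith [pow_pos (show 0 < T by linarith) 2]

/-! ### The lower bound for the mean square of the tail -/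

theorem sum_abs_div_sqrt_le {s : Finset ℕ} (hs : ∀ n ∈ s, 1 ≤ n) {α : ℕ → ℝ} {B : ℝ}
    (h : ∑ n ∈ s, |α n| ≤ B) : ∑ n ∈ s, |α n / √n| ≤ B :=
  (Finset.sum_le_sum fun n hn => abs_div_sqrt_le (α n) (hs n hn)).trans h

/-- The weighted inner product of two Dirichlet polynomials, one of which is shorter than
`T / log² T`, is the diagonal sum up to a Gaussian error. -/
theorem abs_integral_dirPoly_sub_le {T B : ℝ} (hT : 0 < T) (hL : 0 < Real.log T)
    {s s' : Finset ℕ} (hs : ∀ n ∈ s, 1 ≤ n) (hs' : ∀ n ∈ s', 1 ≤ n ∧ (n:ℝ) < cutoff T)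
    {α β : ℕ → ℝ} (hα : ∑ n ∈ s, |α n| ≤ B) (hβ : ∑ n ∈ s', |β n| ≤ B) :
    |(∫ t : ℝ, omega T t * (dirPoly s α t * conj (dirPoly s' β t)).re) -
      ∑ n ∈ s, if n ∈ s' then α n * β n / n else 0| ≤ B * B * Real.exp (-(Real.log T ^ 2 / 16)) := by
  have hx : 0 < cutoff T := div_pos hT (by positivity)
  have h := abs_integral_sub_diagonal_le hT hL (ρ := 1 / (2 * cutoff T)) (by positivity) s s'
    (fun n => α n / √n) (fun n => Real.log n) (fun n => β n / √n) (fun n => Real.log n)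
    (fun m n => m = n) (fun i _ j _ hij => by rw [hij]) (fun i hi j hj hij => by
      rw [abs_sub_comm]
      exact le_abs_log_sub_log (hs' j hj).1 (hs i hi) (Ne.symm hij) (hs' j hj).2)
  -- the gap `1 / (2 x)` is `log² T / (2 T)`
  have e : (1 / (2 * cutoff T)) ^ 2 * T ^ 2 / (4 * Real.log T ^ 2) = Real.log T ^ 2 / 16 := by
    rw [cutoff]; field_simp; norm_num
  rw [e] at h
  have hdiag : ∑ i ∈ s, ∑ j ∈ s', (if i = j then α i / √i * (β j / √j) else 0) =
      ∑ n ∈ s, if n ∈ s' then α n * β n / n else 0 := by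
    refine Finset.sum_congr rfl fun n _ => ?_
    rw [Finset.sum_ite_eq]
    congr 1
    rw [div_mul_div_comm, Real.mul_self_sqrt (Nat.cast_nonneg n)]
  rw [hdiag] at h
  refine h.trans (mul_le_mul_of_nonneg_right ?_ (Real.exp_pos _).le)
  have h1 := sum_abs_div_sqrt_le hs hα
  have h2 := sum_abs_div_sqrt_le (fun n hn => (hs' n hn).1) hβ
  exact mul_le_mul h1 h2 (Finset.sum_nonneg fun _ _ => abs_nonneg _)
    ((Finset.sum_nonneg fun _ _ => abs_nonneg _).trans h1)

/-- The product `A(t) · conj (Y(t))` as an exponential sum with the frequencies `log (m / q)`. -/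
theorem liouvilleD_mul_conj_smoothMangoldt (T t : ℝ) :
    dirPoly (Ico 1 ⌈cutoff T⌉₊) liouvilleD t * conj (dirPoly (Ico 1 ⌈T⌉₊) (smoothMangoldt T) t) =
      expSum (Ico 1 ⌈cutoff T⌉₊ ×ˢ Ico 1 ⌈T⌉₊)
        (fun z => liouvilleD z.1 / √z.1 * (smoothMangoldt T z.2 / √z.2))
        (fun z => Real.log z.1 + -Real.log z.2) t := by
  rw [dirPoly, dirPoly, conj_expSum, expSum_mul]

/-- The weighted inner product of `A(t) · conj (Y(t))` with the test polynomial. A frequency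
`m / q` equals `n` exactly when `m = n q`, which produces `corrCoeff`. -/
theorem abs_integral_corr_sub_le {T : ℝ} (hT : 1 ≤ T) (hL : 0 < Real.log T) (hxT : cutoff T ≤ T) :
    |(∫ t : ℝ, omega T t * (dirPoly (Ico 1 ⌈cutoff T⌉₊) liouvilleD t *
        conj (dirPoly (Ico 1 ⌈T⌉₊) (smoothMangoldt T) t) *
        conj (dirPoly (Ico 1 ⌈cutoff T⌉₊) (testCoeff T) t)).re) -
      logSum (fun n => testCoeff T n * corrCoeff T n) ⌈cutoff T⌉₊| ≤
    (2 * T ^ 3) * (2 * T ^ 3) * Real.exp (-(Real.log T ^ 2 / 16)) := by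
  have hT0 : 0 < T := by linarith
  have hx : 0 < cutoff T := div_pos hT0 (by positivity)
  have h := abs_integral_sub_diagonal_le hT0 hL (ρ := 1 / (2 * cutoff T)) (by positivity)
    (Ico 1 ⌈cutoff T⌉₊ ×ˢ Ico 1 ⌈T⌉₊) (Ico 1 ⌈cutoff T⌉₊)
    (fun z => liouvilleD z.1 / √z.1 * (smoothMangoldt T z.2 / √z.2))
    (fun z => Real.log z.1 + -Real.log z.2) (fun n => testCoeff T n / √n) (fun n => Real.log n)
    (fun z n => z.1 = n * z.2)
    (by
      intro z hz n hn hzn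
      rw [Finset.mem_product, Finset.mem_Ico, Finset.mem_Ico] at hz
      have hn1 := (Finset.mem_Ico.1 hn).1
      have h1 : (n:ℝ) ≠ 0 := by exact_mod_cast (by omega : n ≠ 0)
      have h2 : (z.2:ℝ) ≠ 0 := by
        have := hz.2.1
        exact_mod_cast (by omega : z.2 ≠ 0)
      rw [hzn, Nat.cast_mul, Real.log_mul h1 h2]; ring)
    (by
      intro z hz n hn hzn
      rw [Finset.mem_product, Finset.mem_Ico, Finset.mem_Ico, Nat.lt_ceil] at hz
      have hn1 := (Finset.mem_Ico.1 hn).1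
      have h1 : (n:ℝ) ≠ 0 := by exact_mod_cast (by omega : n ≠ 0)
      have h2 : (z.2:ℝ) ≠ 0 := by
        have := hz.2.1
        exact_mod_cast (by omega : z.2 ≠ 0)
      have h3 := le_abs_log_sub_log hz.1.1 (Nat.mul_pos hn1 hz.2.1) hzn hz.1.2
      rw [Nat.cast_mul, Real.log_mul h1 h2] at h3
      refine h3.trans (le_of_eq ?_)
      congr 1; ring)
  -- the gap `1 / (2 x)` is `log² T / (2 T)`
  have e : (1 / (2 * cutoff T)) ^ 2 * T ^ 2 / (4 * Real.log T ^ 2) = Real.log T ^ 2 / 16 := by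
    rw [cutoff]; field_simp; norm_num
  rw [e] at h
  have hdiag : ∑ z ∈ Ico 1 ⌈cutoff T⌉₊ ×ˢ Ico 1 ⌈T⌉₊, ∑ n ∈ Ico 1 ⌈cutoff T⌉₊,
      (if z.1 = n * z.2 then
        liouvilleD z.1 / √z.1 * (smoothMangoldt T z.2 / √z.2) * (testCoeff T n / √n) else 0) =
      logSum (fun n => testCoeff T n * corrCoeff T n) ⌈cutoff T⌉₊ := by
    rw [Finset.sum_comm, logSum]
    refine Finset.sum_congr rfl fun n hn => ?_
    have hn1 := (Finset.mem_Ico.1 hn).1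
    have hn0 : (1:ℝ) ≤ n := by exact_mod_cast hn1
    rw [Finset.sum_product_right, corrCoeff, Finset.mul_sum, Finset.sum_div]
    symm
    refine Finset.sum_subset_zero_on_sdiff (fun q hq => ?_) (fun q hq => ?_) (fun q hq => ?_)
    · rw [Finset.mem_Ico, Nat.lt_ceil] at hq ⊢
      refine ⟨hq.1, hq.2.trans_le ((div_le_self hx.le hn0).trans hxT)⟩
    · rw [Finset.mem_sdiff, Finset.mem_Ico, Finset.mem_Ico, not_and, Nat.lt_ceil, Nat.lt_ceil] at hq
      refine Finset.sum_eq_zero fun m hm => if_neg fun hmn : m = n * q => ?_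
      refine hq.2 hq.1.1 ?_
      rw [lt_div_iff₀ (by linarith)]
      have := Nat.lt_ceil.1 (Finset.mem_Ico.1 hm).2
      rw [hmn] at this; push_cast at this; linarith
    · rw [Finset.mem_Ico, Nat.lt_ceil, lt_div_iff₀ (by linarith)] at hq
      dsimp only
      rw [Finset.sum_ite_eq', if_pos]
      · have h2 : (0:ℝ) < q := by exact_mod_cast hq.1
        have h3 : (0:ℝ) < n := by linarith
        push_cast
        rw [Real.sqrt_mul h3.le]
        have e1 := Real.mul_self_sqrt h3.le
        have e2 := Real.mul_self_sqrt h2.le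
        have p1 := Real.sqrt_pos.2 h3
        have p2 := Real.sqrt_pos.2 h2
        rw [mul_div_assoc', div_div, div_mul_div_comm, div_mul_div_comm]
        congr 1
        · ring
        · linear_combination (-√(q:ℝ) * √q) * e1 - (n:ℝ) * e2
      · rw [Finset.mem_Ico, Nat.lt_ceil]
        push_cast
        exact ⟨Nat.mul_pos hn1 hq.1, by linarith⟩
  rw [hdiag] at h
  simp only [liouvilleD_mul_conj_smoothMangoldt]
  refine h.trans (mul_le_mul_of_nonneg_right ?_ (Real.exp_pos _).le)
  have h1 : ∑ z ∈ Ico 1 ⌈cutoff T⌉₊ ×ˢ Ico 1 ⌈T⌉₊,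
      |liouvilleD z.1 / √z.1 * (smoothMangoldt T z.2 / √z.2)| ≤ 2 * T ^ 3 := by
    refine (Finset.sum_le_sum fun z hz => ?_).trans (sum_abs_product_le hT0 hL hxT hx.le)
    rw [Finset.mem_product, Finset.mem_Ico, Finset.mem_Ico] at hz
    rw [abs_mul, abs_mul]
    exact mul_le_mul (abs_div_sqrt_le _ hz.1.1) (abs_div_sqrt_le _ hz.2.1) (abs_nonneg _)
      (abs_nonneg _)
  have h2 := sum_abs_div_sqrt_le (fun n hn => (Finset.mem_Ico.1 hn).1)
    (sum_abs_testCoeff_le hT hL hxT hx.le)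
  exact mul_le_mul h1 h2 (Finset.sum_nonneg fun _ _ => abs_nonneg _) (by positivity)

theorem integral_two_mul_sub_sub_sub {f g h k : ℝ → ℝ} (hf : Integrable f) (hg : Integrable g)
    (hh : Integrable h) (hk : Integrable k) :
    ∫ t, (2 * f t - g t - h t - 2 * k t) = 2 * (∫ t, f t) - (∫ t, g t) - (∫ t, h t) - 2 * ∫ t, k t := by
  have e1 := integral_sub' (((hf.const_mul 2).sub hg).sub hh) (hk.const_mul 2)
  have e2 := integral_sub' ((hf.const_mul 2).sub hg) hh
  have e3 := integral_sub' (hf.const_mul 2) hg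
  rw [e2, e3, integral_const_mul, integral_const_mul] at e1
  exact e1

/-- The mean square of the tail is at least `diagonal T`, up to a negligible error. -/
theorem diagonal_sub_le_integral {T : ℝ} (hT : 1 ≤ T) (hL : 1 ≤ Real.log T) (hx : 1 ≤ cutoff T) :
    diagonal T - 24 * (T ^ 6 * Real.exp (-(Real.log T ^ 2 / 16))) ≤
      ∫ t : ℝ, omega T t * ‖tail T t‖ ^ 2 := by
  have hT0 : 0 < T := by linarith
  have hL0 : 0 < Real.log T := by linarith
  have hxT := cutoff_le_self hT0 hL
  have hx0 : 0 ≤ cutoff T := by linarith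
  have hc : ⌈cutoff T⌉₊ ≤ ⌈cutoff T * T⌉₊ := Nat.ceil_mono (le_mul_of_one_le_right hx0 hT)
  have hc1 : 1 ≤ ⌈cutoff T⌉₊ := Nat.one_le_ceil_iff.2 (by linarith)
  set A := dirPoly (Ico 1 ⌈cutoff T⌉₊) liouvilleD
  set Y := dirPoly (Ico 1 ⌈T⌉₊) (smoothMangoldt T)
  set W := dirPoly (Ico 1 ⌈cutoff T⌉₊) (testCoeff T) with hW
  set P := dirPoly (Ico ⌈cutoff T⌉₊ ⌈cutoff T * T⌉₊) (b T) with hP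
  set H := dirPoly (Ico 1 ⌈cutoff T⌉₊) (b T) with hH
  have hfac : ∀ t, H t + P t = A t * Y t := fun t => by
    rw [← dirPoly_b_eq_mul, hH, hP]
    simp only [dirPoly, expSum]
    exact Finset.sum_Ico_consecutive _ hc1 hc
  have hmemx : ∀ n ∈ Ico 1 ⌈cutoff T⌉₊, 1 ≤ n ∧ (n:ℝ) < cutoff T := fun n hn =>
    ⟨(Finset.mem_Ico.1 hn).1, Nat.lt_ceil.1 (Finset.mem_Ico.1 hn).2⟩
  have hbH : ∑ n ∈ Ico 1 ⌈cutoff T⌉₊, |b T n| ≤ 2 * T ^ 3 :=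
    (Finset.sum_le_sum_of_subset_of_nonneg (Finset.Ico_subset_Ico_right hc)
      fun _ _ _ => abs_nonneg _).trans (sum_abs_b_le hT0 hL0 hxT hx0)
  have hbP : ∑ n ∈ Ico ⌈cutoff T⌉₊ ⌈cutoff T * T⌉₊, |b T n| ≤ 2 * T ^ 3 :=
    (Finset.sum_le_sum_of_subset_of_nonneg (Finset.Ico_subset_Ico_left hc1)
      fun _ _ _ => abs_nonneg _).trans (sum_abs_b_le hT0 hL0 hxT hx0)
  have hwt := sum_abs_testCoeff_le hT hL0 hxT hx0
  have i1 := abs_integral_corr_sub_le hT hL0 hxT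
  have i2 := abs_integral_dirPoly_sub_le hT0 hL0 (fun n hn => (hmemx n hn).1) hmemx hwt hwt
  have i3 := abs_integral_dirPoly_sub_le hT0 hL0 (fun n hn => (hmemx n hn).1) hmemx hbH hbH
  have i4 := abs_integral_dirPoly_sub_le hT0 hL0
    (fun n hn => hc1.trans (Finset.mem_Ico.1 hn).1) hmemx hbP hbH
  have d2 : ∑ n ∈ Ico 1 ⌈cutoff T⌉₊, (if n ∈ Ico 1 ⌈cutoff T⌉₊ then
      testCoeff T n * testCoeff T n / n else 0) =
      logSum (fun n => testCoeff T n ^ 2) ⌈cutoff T⌉₊ :=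
    Finset.sum_congr rfl fun n hn => by simp only [if_pos hn, pow_two]
  have d3 : ∑ n ∈ Ico 1 ⌈cutoff T⌉₊, (if n ∈ Ico 1 ⌈cutoff T⌉₊ then
      b T n * b T n / n else 0) = logSum (fun n => b T n ^ 2) ⌈cutoff T⌉₊ :=
    Finset.sum_congr rfl fun n hn => by simp only [if_pos hn, pow_two]
  have d4 : ∑ n ∈ Ico ⌈cutoff T⌉₊ ⌈cutoff T * T⌉₊, (if n ∈ Ico 1 ⌈cutoff T⌉₊ then
      b T n * b T n / n else 0) = 0 :=
    Finset.sum_eq_zero fun n hn => if_neg fun hn' =>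
      absurd (Finset.mem_Ico.1 hn').2 (not_lt.2 (Finset.mem_Ico.1 hn).1)
  rw [d2] at i2
  rw [d3] at i3
  rw [d4, sub_zero] at i4
  have j1 : Integrable fun t => omega T t * (A t * conj (Y t) * conj (W t)).re := by
    simp only [A, Y, liouvilleD_mul_conj_smoothMangoldt]
    exact integrable_omega_mul_re hT0 hL0 _ _ _ _ _ _
  have j2 : Integrable fun t => omega T t * (W t * conj (W t)).re :=
    integrable_omega_mul_re hT0 hL0 _ _ _ _ _ _
  have j3 : Integrable fun t => omega T t * (H t * conj (H t)).re :=
    integrable_omega_mul_re hT0 hL0 _ _ _ _ _ _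
  have j4 : Integrable fun t => omega T t * (P t * conj (H t)).re :=
    integrable_omega_mul_re hT0 hL0 _ _ _ _ _ _
  have j5 : Integrable fun t => omega T t * (P t * conj (P t)).re :=
    integrable_omega_mul_re hT0 hL0 _ _ _ _ _ _
  have hnorm : ∀ t, omega T t * ‖tail T t‖ ^ 2 = omega T t * (P t * conj (P t)).re := fun t => by
    rw [tail_eq_dirPoly hT0.le hx, ← hP, Complex.mul_conj, Complex.ofReal_re,
      Complex.normSq_eq_norm_sq]
  have hmono : ∫ t : ℝ, (2 * (omega T t * (A t * conj (Y t) * conj (W t)).re) -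
      omega T t * (W t * conj (W t)).re - omega T t * (H t * conj (H t)).re -
      2 * (omega T t * (P t * conj (H t)).re)) ≤ ∫ t : ℝ, omega T t * ‖tail T t‖ ^ 2 := by
    refine integral_mono ((((j1.const_mul 2).sub j2).sub j3).sub (j4.const_mul 2))
      (by simp only [hnorm]; exact j5) fun t => ?_
    have := mul_le_mul_of_nonneg_left
      (norm_sq_ge_of_add_eq_mul (w := W t) (hfac t)) (omega_nonneg hT0 hL0 t)
    dsimp only
    rw [tail_eq_dirPoly hT0.le hx, ← hP]
    linarith
  rw [integral_two_mul_sub_sub_sub j1 j2 j3 j4] at hmono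
  rw [diagonal]
  have e : (2 * T ^ 3) * (2 * T ^ 3) * Real.exp (-(Real.log T ^ 2 / 16)) =
      4 * (T ^ 6 * Real.exp (-(Real.log T ^ 2 / 16))) := by ring
  rw [e] at i1 i2 i3 i4
  rw [abs_le] at i1 i2 i3 i4
  linarith [i1.1, i2.2, i3.2, i4.2]

theorem tendsto_pow_mul_exp_neg_log_sq :
    Tendsto (fun T : ℝ => T ^ 6 * Real.exp (-(Real.log T ^ 2 / 16))) atTop (𝓝 0) := by
  have h1 : Tendsto (fun L : ℝ => L * (L / 16 - 6)) atTop atTop :=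
    tendsto_id.atTop_mul_atTop₀ (tendsto_atTop_add_const_right _ _
      (tendsto_id.atTop_div_const (by norm_num)))
  have h2 := (Real.tendsto_exp_neg_atTop_nhds_zero.comp h1).comp Real.tendsto_log_atTop
  refine h2.congr' ?_
  filter_upwards [eventually_gt_atTop 0] with T hT
  have h3 : T ^ 6 = Real.exp (6 * Real.log T) := by
    rw [mul_comm, Real.exp_mul, Real.exp_log hT]; norm_cast
  simp only [Function.comp_apply]
  rw [h3, ← Real.exp_add]
  congr 1; ring

theorem HasLogMean.isA2 {A : ℝ} (h : HasLogMean (fun n => ((d n : ℕ) : ℝ) ^ 2) A 3) : IsA2 A := by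
  obtain ⟨C, hC0, hC⟩ := h.real
  refine Asymptotics.IsBigO.of_bound (C * 2 ^ 3) ?_
  filter_upwards [eventually_ge_atTop 1, Real.tendsto_log_atTop.eventually_ge_atTop 1] with x hx hl
  rw [Real.norm_eq_abs, Real.norm_eq_abs, abs_of_nonneg (by positivity : 0 ≤ Real.log x ^ 3)]
  refine (hC x hx).trans ?_
  rw [mul_assoc, ← mul_pow]
  exact mul_le_mul_of_nonneg_left (pow_le_pow_left₀ (by linarith) (by linarith) 3) hC0

end LongDirichlet

theorem corollary1 :
    ∃ A₂ : ℝ, 0 < A₂ ∧ LongDirichlet.IsA2 A₂ ∧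
      ∀ᶠ T : ℝ in Filter.atTop,
        0.009 * A₂ * Real.log T ^ 4 <
          ∫ t : ℝ, LongDirichlet.omega T t * ‖LongDirichlet.tail T t‖ ^ 2 := by
  obtain ⟨A, hA, h⟩ := LongDirichlet.exists_hasLogMean_sq_d
  refine ⟨A, hA, h.isA2, ?_⟩
  have hlog4 : Tendsto (fun T : ℝ => 0.021 * A * Real.log T ^ 4) atTop atTop :=
    ((tendsto_pow_atTop (by norm_num)).comp Real.tendsto_log_atTop).const_mul_atTop
      (by positivity)
  filter_upwards [LongDirichlet.eventually_diagonal_ge hA h, eventually_ge_atTop 1,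
    Real.tendsto_log_atTop.eventually_ge_atTop 1,
    LongDirichlet.tendsto_cutoff.eventually_ge_atTop 1, hlog4.eventually_ge_atTop 25,
    LongDirichlet.tendsto_pow_mul_exp_neg_log_sq.eventually_le_const (zero_lt_one' ℝ)]
    with T h1 h2 h3 h4 h5 h6
  have := LongDirichlet.diagonal_sub_le_integral h2 h3 h4
  linarith
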